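/- Let $V$ be a bounded real-valued function on $\mathbb Z$ (or on $\mathbb Z_+=\{1,2,\dots\}$) and let $$[H\psi](n)=\psi(n+1)+\psi(n-1)+V(n)\psi(n)$$ be the corresponding discrete Schrödinger operator on $\ell^2(\mathbb Z)$ (or on $\ell^2(\mathbb Z_+)$ with Dirichlet boundary condition $\psi(0)=0$). For $T>0$ put $$a(n,T)=\frac2T\int_0^\infty e^{-2t/T}\,|\langle e^{-itH}\delta_1,\delta_n\rangle|^2\,dt,\qquad P(N,T)=\sum_{|n|>N}a(n,T),$$ and define, with values in $[-\infty,+\infty]$ and with $\log 0=-\infty$, $$\beta^+(p)=\limsup_{T\to\infty}\frac{\log\sum_n|n|^p a(n,T)}{p\log T}\quad(p>0),$$ $$S^+(\gamma)=-\limsup_{T\to\infty}\frac{\log P(T^\gamma-2,T)}{\log T},\qquad \alpha_u^+=\sup\{\gamma\ge 0: S^+(\gamma)<\infty\}.$$ For $z\in\mathbb C$ let $$T(m,z)=\begin{pmatrix} z-V(m)&-1\\1&0\end{pmatrix},\qquad \Phi(n,z)=\begin{cases}T(n,z)\cdots T(1,z)& n\ge1,\\ \mathrm{Id}&n=0,\\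 T(n+1,z)^{-1}\cdots T(0,z)^{-1}&n\le-1\end{cases}$$ (in the case of $\mathbb Z_+$ only for $n\ge0$). **Theorem.** Let $K\ge4$ be such that $\sigma(H)\subseteq[-K+1,K-1]$. Suppose that for some $C\in(0,\infty)$ and $\alpha\in(0,1)$ we have, as $T\to\infty$, $$\int_{-K}^K\Big(\max_{1\le n\le CT^\alpha}\big\|\Phi\big(n,E+\tfrac iT\big)\big\|^2\Big)^{-1}dE=O(T^{-m})$$ and, in the case of $\mathbb Z$, also $$\int_{-K}^K\Big(\max_{1\le -n\le CT^\alpha}\big\|\Phi\big(n,E+\tfrac iT\big)\big\|^2\Big)^{-1}dE=O(T^{-m}),$$ for every integer $m\ge1$. Then $\alpha_u^+\le\alpha$. In particular, $\beta^+(p)\le\alpha$ for every $p>0$. -/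

import Mathlib

open Set Filter Topology Asymptotics MeasureTheory
open scoped ENNReal

noncomputable section

namespace SchrodingerTransport

/-- The two configuration spaces: the whole line `ℤ`, and the half-line `ℤ₊ = {1, 2, …}`
(with Dirichlet boundary condition at `0`). -/
inductive Lattice where
  | line
  | halfLine

/-- The set of sites of the lattice. -/
def Lattice.sites : Lattice → Set ℤ
  | .line => univ
  | .halfLine => {n | 1 ≤ n}

theorem Lattice.one_mem (L : Lattice) : (1 : ℤ) ∈ L.sites := by
  cases L <;> simp [Lattice.sites]

/-- The Hilbert space `ℓ²(ℤ)` or `ℓ²(ℤ₊)`. -/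
abbrev Ell2 (L : Lattice) : Type := lp (fun _ : L.sites => ℂ) 2

open Classical in
/-- The value `ψ(n)` at an arbitrary integer, with `ψ(n) = 0` off the lattice. On the half-line
this is the Dirichlet condition `ψ(0) = 0`; on the line it changes nothing. -/
def val {L : Lattice} (ψ : Ell2 L) (n : ℤ) : ℂ :=
  if h : n ∈ L.sites then ψ ⟨n, h⟩ else 0

theorem val_add {L : Lattice} (ψ φ : Ell2 L) (n : ℤ) : val (ψ + φ) n = val ψ n + val φ n := by
  unfold val; split_ifs <;> simp

theorem val_smul {L : Lattice} (c : ℂ) (ψ : Ell2 L) (n : ℤ) : val (c • ψ) n = c * val ψ n := by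
  unfold val; split_ifs <;> simp

theorem sum_val_le {L : Lattice} (ψ : Ell2 L) (k : ℤ) (s : Finset L.sites) :
    ∑ n ∈ s, ‖val ψ ((n : ℤ) + k)‖ ^ (2 : ℝ≥0∞).toReal ≤ ‖ψ‖ ^ (2 : ℝ≥0∞).toReal := by
  classical
  have h2 : 0 < (2 : ℝ≥0∞).toReal := by norm_num
  let t : Finset ℤ := s.image (fun n : L.sites => (n : ℤ) + k)
  have e1 : ∑ n ∈ s, ‖val ψ ((n : ℤ) + k)‖ ^ (2 : ℝ≥0∞).toReal
      = ∑ m ∈ t, ‖val ψ m‖ ^ (2 : ℝ≥0∞).toReal := by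
    rw [Finset.sum_image]
    intro a _ b _ hab
    exact Subtype.ext (by simpa using hab)
  have e2 : ∑ m ∈ t, ‖val ψ m‖ ^ (2 : ℝ≥0∞).toReal
      = ∑ m ∈ t.filter (· ∈ L.sites), ‖val ψ m‖ ^ (2 : ℝ≥0∞).toReal := by
    rw [Finset.sum_filter]
    refine Finset.sum_congr rfl fun m _ => ?_
    split_ifs with h
    · rfl
    · simp [val, h]
  have e3 : ∑ m ∈ t.filter (· ∈ L.sites), ‖val ψ m‖ ^ (2 : ℝ≥0∞).toReal
      = ∑ j ∈ t.subtype (· ∈ L.sites), ‖ψ j‖ ^ (2 : ℝ≥0∞).toReal := by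
    rw [← Finset.subtype_map, Finset.sum_map]
    refine Finset.sum_congr rfl fun j _ => ?_
    simp [val, j.2]
  rw [e1, e2, e3]
  exact lp.sum_rpow_le_norm_rpow h2 ψ _

/-- The translate `n ↦ ψ(n + k)`, restricted to the lattice, is again in `ℓ²`. -/
def shift {L : Lattice} (k : ℤ) (ψ : Ell2 L) : Ell2 L :=
  ⟨fun n => val ψ ((n : ℤ) + k), memℓp_gen' (sum_val_le ψ k)⟩

theorem norm_shift_le {L : Lattice} (k : ℤ) (ψ : Ell2 L) : ‖shift k ψ‖ ≤ ‖ψ‖ :=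
  lp.norm_le_of_forall_sum_le (by norm_num) (norm_nonneg _) (sum_val_le ψ k)

/-- `V` is a bounded real potential on the lattice. -/
def IsBoundedPotential (L : Lattice) (V : ℤ → ℝ) : Prop :=
  ∃ B : ℝ, ∀ n ∈ L.sites, |V n| ≤ B

theorem sum_mul_le {L : Lattice} {V : ℤ → ℝ} {B : ℝ} (hB : ∀ n ∈ L.sites, |V n| ≤ B)
    (ψ : Ell2 L) (s : Finset L.sites) :
    ∑ n ∈ s, ‖(V n : ℂ) * ψ n‖ ^ (2 : ℝ≥0∞).toReal ≤ (B * ‖ψ‖) ^ (2 : ℝ≥0∞).toReal := by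
  have hB0 : 0 ≤ B := (abs_nonneg _).trans (hB 1 L.one_mem)
  rw [Real.mul_rpow hB0 (norm_nonneg _)]
  calc _ ≤ ∑ n ∈ s, B ^ (2 : ℝ≥0∞).toReal * ‖ψ n‖ ^ (2 : ℝ≥0∞).toReal := by
        refine Finset.sum_le_sum fun n _ => ?_
        rw [norm_mul, Real.mul_rpow (norm_nonneg _) (norm_nonneg _)]
        gcongr
        simpa using hB n n.2
    _ ≤ _ := by
        rw [← Finset.mul_sum]
        gcongr
        exact lp.sum_rpow_le_norm_rpow (by norm_num) ψ s

/-- Multiplication by a bounded potential preserves `ℓ²`. -/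
def mulPotential {L : Lattice} (V : ℤ → ℝ) (hV : IsBoundedPotential L V) (ψ : Ell2 L) : Ell2 L :=
  ⟨fun n => (V n : ℂ) * ψ n, memℓp_gen' (sum_mul_le hV.choose_spec ψ)⟩

theorem norm_mulPotential_le {L : Lattice} (V : ℤ → ℝ) (hV : IsBoundedPotential L V)
    (ψ : Ell2 L) : ‖mulPotential V hV ψ‖ ≤ hV.choose * ‖ψ‖ :=
  lp.norm_le_of_forall_sum_le (by norm_num)
    (mul_nonneg ((abs_nonneg _).trans (hV.choose_spec 1 L.one_mem)) (norm_nonneg _))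
    (sum_mul_le hV.choose_spec ψ)

/-- The discrete Schrödinger operator `[Hψ](n) = ψ(n+1) + ψ(n-1) + V(n) ψ(n)` as a bounded
operator on `ℓ²` of the lattice (see `schrodinger_apply`). -/
def schrodinger (L : Lattice) (V : ℤ → ℝ) (hV : IsBoundedPotential L V) : Ell2 L →L[ℂ] Ell2 L :=
  LinearMap.mkContinuousOfExistsBound
    { toFun := fun ψ => shift 1 ψ + shift (-1) ψ + mulPotential V hV ψ
      map_add' := fun ψ φ => by
        ext n
        change val (ψ + φ) _ + val (ψ + φ) _ + (V n : ℂ) * (ψ n + φ n)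
          = (val ψ _ + val ψ _ + (V n : ℂ) * ψ n) + (val φ _ + val φ _ + (V n : ℂ) * φ n)
        rw [val_add, val_add]
        ring
      map_smul' := fun c ψ => by
        ext n
        change val (c • ψ) _ + val (c • ψ) _ + (V n : ℂ) * (c * ψ n)
          = c * (val ψ _ + val ψ _ + (V n : ℂ) * ψ n)
        rw [val_smul, val_smul]
        ring }
    ⟨1 + 1 + hV.choose, fun ψ => by
      refine (norm_add₃_le).trans ?_
      have h1 := norm_shift_le 1 ψ
      have h2 := norm_shift_le (-1) ψ
      have h3 := norm_mulPotential_le V hV ψ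
      simp only [add_mul, one_mul]
      linarith⟩

theorem schrodinger_apply (L : Lattice) (V : ℤ → ℝ) (hV : IsBoundedPotential L V) (ψ : Ell2 L)
    (n : L.sites) :
    schrodinger L V hV ψ n = val ψ (n + 1) + val ψ (n - 1) + (V n : ℂ) * ψ n := rfl

open Classical in
/-- The standard basis vector `δ_n`. -/
def delta {L : Lattice} (n : L.sites) : Ell2 L := lp.single 2 n (1 : ℂ)

/-- The site `1` of the lattice. -/
def siteOne (L : Lattice) : L.sites := ⟨1, L.one_mem⟩

/-- The unitary group `e^{-itH}` of a bounded operator, as a norm-convergent power series. -/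
def evolution {L : Lattice} (H : Ell2 L →L[ℂ] Ell2 L) (t : ℝ) : Ell2 L →L[ℂ] Ell2 L :=
  NormedSpace.exp ((-(t : ℂ) * Complex.I) • H)

/-- `a(n,T) = (2/T) ∫₀^∞ e^{-2t/T} |⟨e^{-itH} δ₁, δ_n⟩|² dt`. -/
def avgProb {L : Lattice} (H : Ell2 L →L[ℂ] Ell2 L) (n : L.sites) (T : ℝ) : ℝ :=
  2 / T * ∫ t in Ioi (0 : ℝ), Real.exp (-2 * t / T) *
    ‖inner ℂ (evolution H t (delta (siteOne L))) (delta n)‖ ^ 2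

/-- The moment `⟨|X|^p⟩(T) = ∑_n |n|^p a(n,T)`, with values in `[0,∞]`. -/
def moment {L : Lattice} (H : Ell2 L →L[ℂ] Ell2 L) (p T : ℝ) : ℝ≥0∞ :=
  ∑' n : L.sites, ENNReal.ofReal (|((n : ℤ) : ℝ)| ^ p * avgProb H n T)

/-- The outside probability `P(N,T) = ∑_{|n| > N} a(n,T)` (`N` real), with values in `[0,∞]`. -/
def outsideProb {L : Lattice} (H : Ell2 L →L[ℂ] Ell2 L) (N T : ℝ) : ℝ≥0∞ :=
  ∑' n : {n : L.sites // N < |((n : ℤ) : ℝ)|}, ENNReal.ofReal (avgProb H n T)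

/-- The upper transport exponent `β⁺(p) = limsup_{T → ∞} log ⟨|X|^p⟩(T) / (p log T)`, with values
in the extended reals; here `log 0 = -∞`. -/
def betaPlus {L : Lattice} (H : Ell2 L →L[ℂ] Ell2 L) (p : ℝ) : EReal :=
  limsup (fun T : ℝ => ENNReal.log (moment H p T) / ((p * Real.log T : ℝ) : EReal)) atTop

/-- `S⁺(α) = - limsup_{T → ∞} log P(T^α - 2, T) / log T`, with values in the extended reals;
here `log 0 = -∞`. -/
def sPlus {L : Lattice} (H : Ell2 L →L[ℂ] Ell2 L) (α : ℝ) : EReal :=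
  -limsup (fun T : ℝ =>
    ENNReal.log (outsideProb H (T ^ α - 2) T) / ((Real.log T : ℝ) : EReal)) atTop

/-- `α_u⁺ = sup {α ≥ 0 : S⁺(α) < ∞}`, with values in the extended reals. -/
def alphaUPlus {L : Lattice} (H : Ell2 L →L[ℂ] Ell2 L) : EReal :=
  sSup ((fun α : ℝ => (α : EReal)) '' {α : ℝ | 0 ≤ α ∧ sPlus H α < ⊤})

/-- The one-step matrix `T(m,z)`. -/
def stepMatrix (V : ℤ → ℝ) (m : ℤ) (z : ℂ) : Matrix (Fin 2) (Fin 2) ℂ :=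
  !![z - (V m : ℂ), -1; 1, 0]

/-- `T(n,z) ⋯ T(1,z)`. -/
def transferRight (V : ℤ → ℝ) (z : ℂ) : ℕ → Matrix (Fin 2) (Fin 2) ℂ
  | 0 => 1
  | n + 1 => stepMatrix V ((n : ℤ) + 1) z * transferRight V z n

/-- `T(-n+1,z)⁻¹ ⋯ T(0,z)⁻¹`. -/
def transferLeft (V : ℤ → ℝ) (z : ℂ) : ℕ → Matrix (Fin 2) (Fin 2) ℂ
  | 0 => 1
  | n + 1 => (stepMatrix V (-(n : ℤ)) z)⁻¹ * transferLeft V z n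

/-- The transfer matrix `Φ(n,z)`: the product `T(n,z) ⋯ T(1,z)` for `n ≥ 1`, the identity for
`n = 0`, and `T(n+1,z)⁻¹ ⋯ T(0,z)⁻¹` for `n ≤ -1`. -/
def transfer (V : ℤ → ℝ) (n : ℤ) (z : ℂ) : Matrix (Fin 2) (Fin 2) ℂ :=
  if 0 ≤ n then transferRight V z n.toNat else transferLeft V z (-n).toNat

/-- The operator norm of a `2 × 2` matrix acting on Euclidean `ℂ²`. -/
def matNorm (A : Matrix (Fin 2) (Fin 2) ℂ) : ℝ :=
  ‖Matrix.toEuclideanCLM (n := Fin 2) (𝕜 := ℂ) A‖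

/-- `max_{n ∈ S} ‖Φ(n,z)‖²` for a finite set `S` of integers. -/
def maxTransferSq (V : ℤ → ℝ) (S : Set ℤ) (z : ℂ) : ℝ :=
  sSup ((fun n : ℤ => matNorm (transfer V n z) ^ 2) '' S)

/-- `∫_{-K}^{K} (max_{1 ≤ n ≤ N} ‖Φ(n, E + i/T)‖²)⁻¹ dE`. -/
def rightIntegral (V : ℤ → ℝ) (K N T : ℝ) : ℝ :=
  ∫ E in (-K)..K,
    (maxTransferSq V {n : ℤ | 1 ≤ n ∧ (n : ℝ) ≤ N} ((E : ℂ) + Complex.I / (T : ℂ)))⁻¹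

/-- `∫_{-K}^{K} (max_{1 ≤ -n ≤ N} ‖Φ(n, E + i/T)‖²)⁻¹ dE`. -/
def leftIntegral (V : ℤ → ℝ) (K N T : ℝ) : ℝ :=
  ∫ E in (-K)..K,
    (maxTransferSq V {n : ℤ | 1 ≤ -n ∧ -(n : ℝ) ≤ N} ((E : ℂ) + Complex.I / (T : ℂ)))⁻¹

end SchrodingerTransport

end

/-!
Write `u = (H - z)⁻¹ δ₁` with `z = E + i/T`. By Plancherel's theorem, applied to the damped
amplitude `t ↦ e^{-t/T} ⟨e^{-itH} δ₁, δ_n⟩`, the averaged probability is an energy integral,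
`a(n,T) = (πT)⁻¹ ∫ |u(n)|² dE` (`ofReal_avgProb`), so the tails of `u` have to be estimated.

On each half-line `u` solves the difference equation with a single source, of size `|c| ≤ 1 + ‖u‖`,
at the boundary site. The estimates rest on one inequality: if `v` is a square-summable Dirichlet
sequence and only one site contributes to `⟨v, (H - z) v⟩`, then `d ‖v‖²` is at most that
contribution (`FormBound`). It holds with `d = 1/T`, by taking imaginary parts, and with `d = 1`
when `|E| ≥ K`, because the spectral hypothesis gives `‖H‖ ≤ K - 1`. It is used for two sequences.

* Cutting `u` off below a site gives exponential decay of its tails (`IsGreen.tail_decay`). For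
  `|E| ≥ K` the rate does not depend on `T`, so these energies contribute exponentially little.
  With `d = 1/T` the decay on the scale `T` makes the sites beyond `T²` negligible for all moments.
* Gluing the Dirichlet solution `φ` up to the site `n` to `u` beyond `n` gives, by the Wronskian
  identity, `c` times a Green function. Hence `|φ(n)|² ∑_{m ≥ n} |u(m)|² ≤ |c|² T²`. As `φ` and `u`
  together determine the transfer matrix, `‖Φ(n,z)‖² ∑_{m > n} |u(m)|²` is at most a power of `T`
  (`IsGreen.tail_mul_entrySq_le`).

Choosing for every energy the site `1 ≤ n ≤ C T ^ α` with the largest transfer matrix and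
integrating over `[-K, K]`, the hypotheses show that `P(T ^ γ - 2, T)` decays faster than any power
of `T` for each `γ > α` (`eventually_outsideProb_le`), that is `S⁺(γ) = ∞`. To the moment of order
`p` the sites within `T ^ γ` contribute at most `T ^ (pγ)`, the further sites up to `T²` contribute
at most `1` for large `T`, and the remote sites a bounded amount (`eventually_moment_le`).
-/

namespace SchrodingerTransport

section

/-! ### Half-line sequences: decay and transfer matrices -/

/-- The residual `f(k+2) + f(k) + (W(k+1) - z) f(k+1)` of the difference equation at the site
`k + 1`, for a sequence `f` on `{0, 1, 2, …}` whose value at `0` is the boundary value. -/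
def residual (W : ℤ → ℝ) (z : ℂ) (f : ℕ → ℂ) (k : ℕ) : ℂ :=
  f (k + 2) + f k + ((W ((k : ℤ) + 1) : ℂ) - z) * f (k + 1)

/-- The lower bound `d ‖f‖² ≤ |⟨f, (H - z) f⟩|` for square-summable Dirichlet sequences `f` on the
half-line for which at most one site, `k + 1`, contributes to the form on the right. -/
def FormBound (W : ℤ → ℝ) (z : ℂ) (d : ℝ) : Prop :=
  ∀ f : ℕ → ℂ, f 0 = 0 → Summable (fun j => ‖f j‖ ^ 2) →
    ∀ k, (∀ j, j ≠ k → f (j + 1) = 0 ∨ residual W z f j = 0) →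
      d * ∑' j, ‖f j‖ ^ 2 ≤ ‖f (k + 1)‖ * ‖residual W z f k‖

/-- `u` is the square-summable Dirichlet solution of `(H - z) u = c δ₁` on the half-line. -/
structure IsGreen (W : ℤ → ℝ) (z c : ℂ) (u : ℕ → ℂ) : Prop where
  zero : u 0 = 0
  summable : Summable fun j => ‖u j‖ ^ 2
  source : residual W z u 0 = c
  solves : ∀ k, residual W z u (k + 1) = 0

/-- The tail `∑_{m ≥ n} |u(m)|²`. -/
noncomputable def tailSq (u : ℕ → ℂ) (n : ℕ) : ℝ := ∑' m, ‖u (m + n)‖ ^ 2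

variable {W : ℤ → ℝ} {z c : ℂ} {d : ℝ} {u f : ℕ → ℂ}

theorem summable_tail (hf : Summable fun j => ‖f j‖ ^ 2) (n : ℕ) :
    Summable fun m => ‖f (m + n)‖ ^ 2 :=
  (summable_nat_add_iff (f := fun j => ‖f j‖ ^ 2) n).2 hf

theorem tailSq_eq_add (hf : Summable fun j => ‖f j‖ ^ 2) (n : ℕ) :
    tailSq f n = ‖f n‖ ^ 2 + tailSq f (n + 1) := by
  unfold tailSq
  rw [(summable_tail hf n).tsum_eq_zero_add]
  simp [add_right_comm, add_assoc]

theorem tailSq_nonneg (f : ℕ → ℂ) (n : ℕ) : 0 ≤ tailSq f n :=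
  tsum_nonneg fun _ => by positivity

theorem tailSq_anti (hf : Summable fun j => ‖f j‖ ^ 2) : Antitone (tailSq f) :=
  antitone_nat_of_succ_le fun n => by
    rw [tailSq_eq_add hf n]
    linarith [sq_nonneg ‖f n‖]

theorem tailSq_zero (f : ℕ → ℂ) : tailSq f 0 = ∑' j, ‖f j‖ ^ 2 := rfl

theorem norm_sq_le_tailSq (hf : Summable fun j => ‖f j‖ ^ 2) (n : ℕ) :
    ‖f n‖ ^ 2 ≤ tailSq f n := by
  rw [tailSq_eq_add hf n]
  linarith [tailSq_nonneg f (n + 1)]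

/-- Cutting the decaying solution off below a site leaves a single source there, so the form bound
compares two consecutive tails. -/
theorem IsGreen.tail_step (hu : IsGreen W z c u) (hd : 0 ≤ d) (hF : FormBound W z d) (k : ℕ) :
    (1 + 2 * d) * tailSq u (k + 3) ≤ tailSq u (k + 1) := by
  set g : ℕ → ℂ := fun j => if k + 2 ≤ j then u j else 0 with hg
  have hg1 : ∀ m, g (m + (k + 2)) = u (m + (k + 2)) := fun m => by simp [hg]
  have hgs : Summable fun j => ‖g j‖ ^ 2 := by
    rw [← summable_nat_add_iff (k + 2)]
    simpa only [hg1] using summable_tail hu.summable (k + 2)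
  have h := hF g (by simp [hg]) hgs (k + 1) (fun j hj => by
    rcases lt_or_gt_of_ne hj with h | h
    · left
      simp only [hg]
      rw [if_neg (by omega)]
    · right
      obtain ⟨i, rfl⟩ : ∃ i, j = i + 1 := ⟨j - 1, by omega⟩
      rw [← hu.solves i]
      unfold residual
      simp only [hg]
      rw [if_pos (by omega), if_pos (by omega), if_pos (by omega)])
  have hr : residual W z g (k + 1) = - u (k + 1) := by
    have := hu.solves k
    unfold residual at this ⊢
    simp only [hg]
    rw [if_pos (by omega), if_neg (by omega), if_pos (by omega)]
    linear_combination this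
  have hg2 : g (k + 1 + 1) = u (k + 2) := by simp [hg]
  rw [hr, norm_neg, hg2] at h
  have h1 : tailSq u (k + 2) ≤ ∑' j, ‖g j‖ ^ 2 := by
    rw [← tailSq_zero]
    refine le_trans (le_of_eq ?_) (tailSq_anti hgs (Nat.zero_le (k + 2)))
    simp only [tailSq, hg1]
  have e1 := tailSq_eq_add hu.summable (k + 1)
  have e2 := tailSq_eq_add hu.summable (k + 2)
  have h2 : d * tailSq u (k + 2) ≤ ‖u (k + 2)‖ * ‖u (k + 1)‖ :=
    (mul_le_mul_of_nonneg_left h1 hd).trans h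
  have h3 : d * tailSq u (k + 3) ≤ d * tailSq u (k + 2) :=
    mul_le_mul_of_nonneg_left (tailSq_anti hu.summable (by omega)) hd
  nlinarith [sq_nonneg (‖u (k + 2)‖ - ‖u (k + 1)‖)]

/-- Exponential decay of the decaying solution, at a rate governed by the form bound. -/
theorem IsGreen.tail_decay (hu : IsGreen W z c u) (hd : 0 ≤ d) (hF : FormBound W z d) (k : ℕ) :
    (1 + 2 * d) ^ k * tailSq u (2 * k + 1) ≤ tailSq u 1 := by
  induction k with
  | zero => simp
  | succ k ih =>
    refine le_trans ?_ ih
    rw [pow_succ, mul_assoc]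
    exact mul_le_mul_of_nonneg_left (hu.tail_step hd hF (2 * k)) (by positivity)

/-- The form bound at a single source of strength `c` bounds the norm by `|c| / d`. -/
theorem FormBound.norm_le (hF : FormBound W z d) (hd : 0 ≤ d) (h0 : f 0 = 0)
    (hf : Summable fun j => ‖f j‖ ^ 2) (k : ℕ)
    (hk : ∀ j, j ≠ k → f (j + 1) = 0 ∨ residual W z f j = 0) :
    d ^ 2 * ∑' j, ‖f j‖ ^ 2 ≤ ‖residual W z f k‖ ^ 2 := by
  have h := hF f h0 hf k hk
  set S := ∑' j, ‖f j‖ ^ 2 with hS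
  have h1 : ‖f (k + 1)‖ ^ 2 ≤ S := hf.le_tsum (k + 1) fun _ _ => by positivity
  have hS0 : 0 ≤ S := le_trans (by positivity) h1
  rcases hS0.eq_or_lt with h2 | h2
  · rw [← h2]; simp
  · have h3 : (d * S) ^ 2 ≤ S * ‖residual W z f k‖ ^ 2 :=
      calc (d * S) ^ 2 ≤ (‖f (k + 1)‖ * ‖residual W z f k‖) ^ 2 :=
            pow_le_pow_left₀ (by positivity) h 2
        _ = ‖f (k + 1)‖ ^ 2 * ‖residual W z f k‖ ^ 2 := by ring
        _ ≤ _ := by gcongr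
    refine le_of_mul_le_mul_left ?_ h2
    linarith [h3]

theorem IsGreen.norm_le (hu : IsGreen W z c u) (hd : 0 ≤ d) (hF : FormBound W z d) :
    d ^ 2 * tailSq u 0 ≤ ‖c‖ ^ 2 := by
  rw [tailSq_zero, ← hu.source]
  refine hF.norm_le hd hu.zero hu.summable 0 fun j hj => Or.inr ?_
  obtain ⟨i, rfl⟩ := Nat.exists_eq_succ_of_ne_zero hj
  exact hu.solves i

theorem transferRight_succ_zero (W : ℤ → ℝ) (z : ℂ) (n : ℕ) (i : Fin 2) :
    transferRight W z (n + 1) 0 i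
      = (z - W ((n : ℤ) + 1)) * transferRight W z n 0 i - transferRight W z n 1 i := by
  simp [transferRight, stepMatrix, Matrix.mul_apply, Fin.sum_univ_two]
  ring

theorem transferRight_succ_one (W : ℤ → ℝ) (z : ℂ) (n : ℕ) (i : Fin 2) :
    transferRight W z (n + 1) 1 i = transferRight W z n 0 i := by
  simp [transferRight, stepMatrix, Matrix.mul_apply, Fin.sum_univ_two]

/-- The Dirichlet solution `φ(0) = 0`, `φ(1) = 1`, read off from the transfer matrices. -/
noncomputable def dirichletSol (W : ℤ → ℝ) (z : ℂ) (n : ℕ) : ℂ := transferRight W z n 1 0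

theorem dirichletSol_zero (W : ℤ → ℝ) (z : ℂ) : dirichletSol W z 0 = 0 := by
  simp [dirichletSol, transferRight]

theorem dirichletSol_one (W : ℤ → ℝ) (z : ℂ) : dirichletSol W z 1 = 1 := by
  simp [dirichletSol, transferRight, stepMatrix]

theorem dirichletSol_succ (W : ℤ → ℝ) (z : ℂ) (n : ℕ) :
    dirichletSol W z (n + 1) = transferRight W z n 0 0 := transferRight_succ_one W z n 0

theorem residual_dirichletSol (W : ℤ → ℝ) (z : ℂ) (n : ℕ) :
    residual W z (dirichletSol W z) n = 0 := by
  unfold residual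
  rw [dirichletSol_succ, dirichletSol_succ, transferRight_succ_zero, dirichletSol]
  ring

/-- The Wronskian of the Dirichlet solution and the decaying solution equals the source. -/
theorem IsGreen.wronskian (hu : IsGreen W z c u) (n : ℕ) :
    dirichletSol W z (n + 1) * u (n + 2) - u (n + 1) * dirichletSol W z (n + 2) = c := by
  induction n with
  | zero =>
    have h1 := residual_dirichletSol W z 0
    have h2 := hu.source
    unfold residual at h1 h2
    simp only [dirichletSol_zero, dirichletSol_one, hu.zero, zero_add] at *
    linear_combination h2 - u 1 * h1
  | succ n ih =>
    have h1 := residual_dirichletSol W z (n + 1)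
    have h2 := hu.solves n
    unfold residual at h1 h2
    linear_combination ih + dirichletSol W z (n + 2) * h2 - u (n + 2) * h1

/-- Gluing the Dirichlet solution to the decaying solution at the site `n + 1` gives a multiple of
the Green function with source at `n + 1`; its norm bounds the product of the Dirichlet solution
with the tail of the decaying one. -/
theorem IsGreen.dirichletSol_mul_tail (hu : IsGreen W z c u) (hd : 0 ≤ d)
    (hF : FormBound W z d) (k : ℕ) :
    d ^ 2 * (‖dirichletSol W z (k + 1)‖ ^ 2 * tailSq u (k + 1)) ≤ ‖c‖ ^ 2 := by
  set φ := dirichletSol W z with hφ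
  -- The two branches agree at `j = k + 1`, the site of the source.
  set v : ℕ → ℂ := fun j => if j ≤ k then u (k + 1) * φ j else φ (k + 1) * u j with hv
  have hv1 : ∀ m, v (m + (k + 1)) = φ (k + 1) * u (m + (k + 1)) := fun m => by
    simp only [hv]; rw [if_neg (by omega)]
  have hvs : Summable fun j => ‖v j‖ ^ 2 := by
    rw [← summable_nat_add_iff (k + 1)]
    simp only [hv1, norm_mul, mul_pow]
    exact (summable_tail hu.summable (k + 1)).mul_left _
  have hvk : v (k + 1) = u (k + 1) * φ (k + 1) := by
    simp [hv]; ring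
  have hle : ∀ j ≤ k + 1, v j = u (k + 1) * φ j := fun j hj => by
    rcases Nat.lt_or_ge k j with h | h
    · obtain rfl : j = k + 1 := by omega
      exact hvk
    · simp [hv, h]
  have hge : ∀ j, k + 1 ≤ j → v j = φ (k + 1) * u j := fun j hj => by
    simp only [hv]; rw [if_neg (by omega)]
  have hres : residual W z v k = c := by
    have h1 := residual_dirichletSol W z k
    rw [← hu.wronskian k]
    unfold residual at h1 ⊢
    rw [hge (k + 2) (by omega), hle k (by omega), hvk]
    linear_combination u (k + 1) * h1
  have h := hF.norm_le hd (f := v) (by rw [hle 0 (by omega), hφ, dirichletSol_zero, mul_zero])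
    hvs k (fun j hj => by
      right
      rcases lt_or_gt_of_ne hj with h | h
      · have h1 := residual_dirichletSol W z j
        unfold residual at h1 ⊢
        rw [hle _ (by omega), hle _ (by omega), hle _ (by omega)]
        linear_combination u (k + 1) * h1
      · obtain ⟨i, rfl⟩ : ∃ i, j = i + 1 := ⟨j - 1, by omega⟩
        have h1 := hu.solves i
        unfold residual at h1 ⊢
        rw [hge _ (by omega), hge _ (by omega), hge _ (by omega)]
        linear_combination φ (k + 1) * h1)
  rw [hres] at h
  refine le_trans (mul_le_mul_of_nonneg_left ?_ (by positivity)) h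
  rw [← tailSq_zero]
  refine le_trans (le_of_eq ?_) (tailSq_anti hvs (Nat.zero_le (k + 1)))
  simp only [tailSq, hv1, norm_mul, mul_pow, tsum_mul_left]

/-- The second column of the transfer matrix in terms of the first column and the decaying
solution. -/
theorem IsGreen.transferRight_col (hu : IsGreen W z c u) (n : ℕ) :
    c * transferRight W z (n + 1) 0 1 = u 1 * transferRight W z (n + 1) 0 0 - u (n + 2) ∧
    c * transferRight W z (n + 1) 1 1 = u 1 * transferRight W z (n + 1) 1 0 - u (n + 1) := by
  induction n with
  | zero =>
    have h2 := hu.source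
    unfold residual at h2
    rw [hu.zero] at h2
    simp [transferRight, stepMatrix] at h2 ⊢
    linear_combination h2
  | succ n ih =>
    have h2 := hu.solves n
    unfold residual at h2
    simp only [transferRight_succ_zero W z (n + 1), transferRight_succ_one W z (n + 1)]
    refine ⟨?_, ih.1⟩
    linear_combination (z - W (((n + 1 : ℕ) : ℤ) + 1)) * ih.1 - ih.2 + h2

/-- The sum of the squared entries of a `2 × 2` matrix. -/
noncomputable def entrySq (A : Matrix (Fin 2) (Fin 2) ℂ) : ℝ := ∑ i, ∑ j, ‖A i j‖ ^ 2

/-- Growth of the transfer matrix at `n` forces smallness of the decaying solution beyond `n`. -/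
theorem IsGreen.tail_mul_entrySq_le (hu : IsGreen W z c u) (hd : 0 < d) (hd1 : d ≤ 1)
    (hF : FormBound W z d) {n : ℕ} (hn : 1 ≤ n) :
    d ^ 4 * (tailSq u (n + 1) * entrySq (transferRight W z n)) ≤ 8 * ‖c‖ ^ 2 := by
  obtain ⟨k, rfl⟩ : ∃ k, n = k + 1 := ⟨n - 1, by omega⟩
  set M := transferRight W z (k + 1) with hM
  set S := tailSq u (k + 1 + 1) with hS
  have hS0 : 0 ≤ S := tailSq_nonneg _ _
  have hN := hu.norm_le hd.le hF
  have hs := hu.summable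
  have hanti := tailSq_anti hs
  have hSN : d ^ 2 * S ≤ ‖c‖ ^ 2 :=
    (mul_le_mul_of_nonneg_left (hanti (Nat.zero_le _)) (by positivity)).trans hN
  -- The second column of `M` is recovered only after division by `c`; for `c = 0` also `u = 0`.
  rcases eq_or_ne c 0 with hc | hc
  · have : S = 0 := by
      have : d ^ 2 * S ≤ 0 := by simpa [hc] using hSN
      have h2 : 0 < d ^ 2 := by positivity
      nlinarith
    simp [this, hc]
  -- The first column of `M` consists of values of the Dirichlet solution.
  have hp : d ^ 2 * (‖M 0 0‖ ^ 2 * S) ≤ ‖c‖ ^ 2 := by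
    have := hu.dirichletSol_mul_tail hd.le hF (k + 1)
    rwa [dirichletSol_succ] at this
  have hq : d ^ 2 * (‖M 1 0‖ ^ 2 * S) ≤ ‖c‖ ^ 2 := by
    refine le_trans ?_ (hu.dirichletSol_mul_tail hd.le hF k)
    have : S ≤ tailSq u (k + 1) := hanti (by omega)
    rw [dirichletSol]
    gcongr
  have hu1 : d ^ 2 * ‖u 1‖ ^ 2 ≤ ‖c‖ ^ 2 := by
    refine le_trans ?_ hN
    gcongr
    exact (norm_sq_le_tailSq hs 1).trans (hanti (Nat.zero_le _))
  have hu2 : d ^ 2 * (‖u (k + 1)‖ ^ 2 + ‖u (k + 2)‖ ^ 2) ≤ ‖c‖ ^ 2 := by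
    refine le_trans ?_ hN
    gcongr
    refine le_trans ?_ (hanti (Nat.zero_le (k + 1)))
    rw [tailSq_eq_add hs (k + 1)]
    have := norm_sq_le_tailSq hs (k + 2)
    linarith
  have key : ∀ a b e : ℂ, c * a = u 1 * b - e →
      ‖c‖ ^ 2 * ‖a‖ ^ 2 ≤ 2 * ‖u 1‖ ^ 2 * ‖b‖ ^ 2 + 2 * ‖e‖ ^ 2 := by
    intro a b e h
    have h1 : ‖c‖ * ‖a‖ ≤ ‖u 1‖ * ‖b‖ + ‖e‖ := by
      rw [← norm_mul, h, ← norm_mul]; exact norm_sub_le _ _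
    have h2 := pow_le_pow_left₀ (by positivity) h1 2
    nlinarith [sq_nonneg (‖u 1‖ * ‖b‖ - ‖e‖)]
  obtain ⟨c1, c2⟩ := hu.transferRight_col k
  have k1 := key _ _ _ c1
  have k2 := key _ _ _ c2
  rw [← hM] at k1 k2
  have hc0 : 0 < ‖c‖ ^ 2 := by positivity
  have t1 : ‖c‖ ^ 2 * (d ^ 4 * (S * (‖M 0 1‖ ^ 2 + ‖M 1 1‖ ^ 2)))
      ≤ ‖c‖ ^ 2 * (6 * ‖c‖ ^ 2) :=
    calc _ = (d ^ 4 * S) * (‖c‖ ^ 2 * ‖M 0 1‖ ^ 2 + ‖c‖ ^ 2 * ‖M 1 1‖ ^ 2) := by ring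
      _ ≤ (d ^ 4 * S) * ((2 * ‖u 1‖ ^ 2 * ‖M 0 0‖ ^ 2 + 2 * ‖u (k + 2)‖ ^ 2)
            + (2 * ‖u 1‖ ^ 2 * ‖M 1 0‖ ^ 2 + 2 * ‖u (k + 1)‖ ^ 2)) := by gcongr
      _ = 2 * ((d ^ 2 * ‖u 1‖ ^ 2) * (d ^ 2 * (‖M 0 0‖ ^ 2 * S)))
          + 2 * ((d ^ 2 * ‖u 1‖ ^ 2) * (d ^ 2 * (‖M 1 0‖ ^ 2 * S)))
          + 2 * ((d ^ 2 * S) * (d ^ 2 * (‖u (k + 1)‖ ^ 2 + ‖u (k + 2)‖ ^ 2))) := by ring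
      _ ≤ 2 * (‖c‖ ^ 2 * ‖c‖ ^ 2) + 2 * (‖c‖ ^ 2 * ‖c‖ ^ 2) + 2 * (‖c‖ ^ 2 * ‖c‖ ^ 2) := by
          gcongr
      _ = _ := by ring
  have t2 := le_of_mul_le_mul_left t1 hc0
  have hd2 : d ^ 2 ≤ 1 := pow_le_one₀ hd.le hd1
  have t3 : ∀ x : ℝ, 0 ≤ x → d ^ 2 * x ≤ ‖c‖ ^ 2 → d ^ 4 * x ≤ ‖c‖ ^ 2 := by
    intro x hx h
    have : d ^ 4 * x = d ^ 2 * (d ^ 2 * x) := by ring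
    rw [this]
    have h0 : 0 ≤ d ^ 2 * x := by positivity
    nlinarith
  have hp' := t3 _ (by positivity) hp
  have hq' := t3 _ (by positivity) hq
  simp only [entrySq, Fin.sum_univ_two]
  nlinarith

end

section

/-! ### Norms of transfer matrices, and reflection -/

theorem matNorm_nonneg (A : Matrix (Fin 2) (Fin 2) ℂ) : 0 ≤ matNorm A := norm_nonneg _

theorem matNorm_sq_le_entrySq (A : Matrix (Fin 2) (Fin 2) ℂ) : matNorm A ^ 2 ≤ entrySq A := by
  have h0 : 0 ≤ entrySq A := Finset.sum_nonneg fun _ _ => Finset.sum_nonneg fun _ _ => by positivity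
  rw [← Real.le_sqrt (matNorm_nonneg A) h0]
  refine ContinuousLinearMap.opNorm_le_bound _ (Real.sqrt_nonneg _) fun x => ?_
  rw [EuclideanSpace.norm_eq, EuclideanSpace.norm_eq, ← Real.sqrt_mul h0]
  refine Real.sqrt_le_sqrt ?_
  rw [entrySq, Finset.sum_mul]
  refine Finset.sum_le_sum fun i _ => ?_
  have h1 : ‖(Matrix.toEuclideanCLM (n := Fin 2) (𝕜 := ℂ) A x) i‖ ≤ ∑ j, ‖A i j‖ * ‖x j‖ := by
    rw [Matrix.ofLp_toEuclideanCLM]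
    simp only [Matrix.mulVec, dotProduct]
    exact (norm_sum_le _ _).trans_eq (Finset.sum_congr rfl fun _ _ => norm_mul _ _)
  calc _ ≤ (∑ j, ‖A i j‖ * ‖x j‖) ^ 2 := pow_le_pow_left₀ (norm_nonneg _) h1 2
    _ ≤ _ := Finset.sum_mul_sq_le_sq_mul_sq _ _ _

theorem matNorm_pos {A : Matrix (Fin 2) (Fin 2) ℂ} (hA : A ≠ 0) : 0 < matNorm A := by
  rw [matNorm, norm_pos_iff]
  simpa using hA

/-- The reflection `n ↦ 1 - n` of the line, or the identity: it carries the sites `1, 2, …` onto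
the right half-line, or onto the left half-line `0, -1, …`. -/
def reflect (σ : Bool) (n : ℤ) : ℤ := if σ then n else 1 - n

@[simp] theorem reflect_true (n : ℤ) : reflect true n = n := rfl
@[simp] theorem reflect_false (n : ℤ) : reflect false n = 1 - n := rfl

theorem reflect_reflect (σ : Bool) (n : ℤ) : reflect σ (reflect σ n) = n := by
  cases σ <;> simp

theorem reflect_injective (σ : Bool) : Function.Injective (reflect σ) :=
  Function.LeftInverse.injective (reflect_reflect σ)

theorem stepMatrix_det (V : ℤ → ℝ) (m : ℤ) (z : ℂ) : (stepMatrix V m z).det = 1 := by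
  simp [stepMatrix, Matrix.det_fin_two]

theorem stepMatrix_inv (V : ℤ → ℝ) (m : ℤ) (z : ℂ) :
    (stepMatrix V m z)⁻¹ = !![0, 1; -1, z - (V m : ℂ)] := by
  rw [Matrix.inv_def, stepMatrix_det]
  simp [stepMatrix, Matrix.adjugate_fin_two]

/-- Reflection turns the transfer matrices to the left into transfer matrices to the right, up to
exchanging the two coordinates. -/
theorem transferLeft_apply (V : ℤ → ℝ) (z : ℂ) (n : ℕ) (i j : Fin 2) :
    transferLeft V z n i j
      = transferRight (fun k => V (reflect false k)) z n (Equiv.swap 0 1 i) (Equiv.swap 0 1 j) := by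
  induction n generalizing i j with
  | zero => fin_cases i <;> fin_cases j <;> simp [transferLeft, transferRight]
  | succ n ih =>
    have e : (1 : ℤ) - ((n : ℤ) + 1) = -n := by ring
    rw [transferLeft, transferRight, stepMatrix_inv, stepMatrix, Matrix.mul_apply,
      Matrix.mul_apply, Fin.sum_univ_two, Fin.sum_univ_two, ih, ih]
    fin_cases i <;> simp [e]
    ring

/-- On either side the transfer matrix is bounded by the entries of a product to the right, for the
reflected potential. -/
theorem matNorm_transfer_sq_le (V : ℤ → ℝ) (z : ℂ) (σ : Bool) {n : ℕ} (hn : 1 ≤ n) :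
    matNorm (transfer V (if σ then n else -n) z) ^ 2
      ≤ entrySq (transferRight (fun k => V (reflect σ k)) z n) := by
  cases σ with
  | true =>
    simp only [if_true, reflect_true, transfer]
    rw [if_pos (by omega), Int.toNat_natCast]
    exact matNorm_sq_le_entrySq _
  | false =>
    simp only [Bool.false_eq_true, if_false, transfer]
    rw [if_neg (by omega), neg_neg, Int.toNat_natCast]
    refine (matNorm_sq_le_entrySq _).trans (le_of_eq ?_)
    simp only [entrySq, Fin.sum_univ_two, transferLeft_apply, Equiv.swap_apply_left,
      Equiv.swap_apply_right]
    ring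

theorem transferRight_det (V : ℤ → ℝ) (z : ℂ) (n : ℕ) : (transferRight V z n).det = 1 := by
  induction n with
  | zero => simp [transferRight]
  | succ n ih => rw [transferRight, Matrix.det_mul, stepMatrix_det, ih, one_mul]

theorem transferLeft_det (V : ℤ → ℝ) (z : ℂ) (n : ℕ) : (transferLeft V z n).det = 1 := by
  induction n with
  | zero => simp [transferLeft]
  | succ n ih =>
    rw [transferLeft, Matrix.det_mul, ih, stepMatrix_inv]
    simp [Matrix.det_fin_two]

theorem matNorm_transfer_pos (V : ℤ → ℝ) (n : ℤ) (z : ℂ) : 0 < matNorm (transfer V n z) := by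
  refine matNorm_pos fun h => ?_
  have hd : (transfer V n z).det = 1 := by
    unfold transfer
    split_ifs
    · exact transferRight_det V z _
    · exact transferLeft_det V z _
  rw [h] at hd
  simp at hd

theorem continuous_transfer (V : ℤ → ℝ) (n : ℤ) : Continuous fun z => transfer V n z := by
  unfold transfer
  split_ifs
  · induction n.toNat with
    | zero => exact continuous_const
    | succ k ih =>
      refine Continuous.matrix_mul ?_ ih
      refine continuous_matrix fun i j => ?_
      fin_cases i <;> fin_cases j <;> simp [stepMatrix] <;> fun_prop
  · induction (-n).toNat with
    | zero => exact continuous_const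
    | succ k ih =>
      refine Continuous.matrix_mul ?_ ih
      simp only [stepMatrix_inv]
      refine continuous_matrix fun i j => ?_
      fin_cases i <;> fin_cases j <;> simp <;> fun_prop

theorem continuous_matNorm_transfer (V : ℤ → ℝ) (n : ℤ) :
    Continuous fun z => matNorm (transfer V n z) := by
  have h : Continuous fun A : Matrix (Fin 2) (Fin 2) ℂ =>
      Matrix.toEuclideanCLM (n := Fin 2) (𝕜 := ℂ) A :=
    (Matrix.toEuclideanCLM (n := Fin 2)
      (𝕜 := ℂ)).toAlgEquiv.toLinearMap.continuous_of_finiteDimensional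
  exact (h.comp (continuous_transfer V n)).norm

/-! ### The Schrödinger operator: symmetry and form bounds -/

variable {L : Lattice}

theorem val_of_mem (ψ : Ell2 L) {n : ℤ} (h : n ∈ L.sites) : val ψ n = ψ ⟨n, h⟩ := dif_pos h

@[simp] theorem val_coe (ψ : Ell2 L) (n : L.sites) : val ψ n = ψ n := val_of_mem ψ n.2

theorem val_of_notMem (ψ : Ell2 L) {n : ℤ} (h : n ∉ L.sites) : val ψ n = 0 := dif_neg h

theorem hasSum_norm_sq (ψ : Ell2 L) : HasSum (fun n => ‖ψ n‖ ^ 2) (‖ψ‖ ^ 2) := by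
  have h := lp.hasSum_norm (p := 2) (by norm_num) ψ
  simpa using h

theorem inner_eq_tsum_val (f g : Ell2 L) :
    inner ℂ f g = ∑' n : ℤ, (starRingEnd ℂ) (val f n) * val g n := by
  rw [lp.inner_eq_tsum]
  have h : ∀ n : L.sites, inner ℂ (f n) (g n)
      = (fun n : ℤ => (starRingEnd ℂ) (val f n) * val g n) n := fun n => by
    simp [mul_comm]
  simp only [h]
  rw [tsum_subtype L.sites (fun n : ℤ => (starRingEnd ℂ) (val f n) * val g n)]
  congr 1
  ext n
  by_cases hn : n ∈ L.sites
  · simp [hn]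
  · simp [hn, val_of_notMem _ hn]

theorem inner_shift (k : ℤ) (f g : Ell2 L) : inner ℂ (shift k f) g = inner ℂ f (shift (-k) g) := by
  rw [inner_eq_tsum_val, inner_eq_tsum_val, ← (Equiv.addRight (-k)).tsum_eq]
  congr 1
  ext n
  simp only [Equiv.coe_addRight]
  have h1 : ∀ (j : ℤ) (φ : Ell2 L) (m : ℤ), m ∈ L.sites → val (shift j φ) m = val φ (m + j) :=
    fun j φ m hm => val_of_mem _ hm
  by_cases hn : n ∈ L.sites <;> by_cases hm : n + -k ∈ L.sites
  · rw [h1 _ _ _ hn, h1 _ _ _ hm]; simp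
  · rw [h1 _ _ _ hn, val_of_notMem _ hm, val_of_notMem g hm]; simp
  · rw [h1 _ _ _ hm, val_of_notMem f (n := n) hn]; simp [val_of_notMem f hn]
  · rw [val_of_notMem g hm, val_of_notMem f hn]; simp

theorem schrodinger_isSelfAdjoint (L : Lattice) (V : ℤ → ℝ) (hV : IsBoundedPotential L V) :
    IsSelfAdjoint (schrodinger L V hV) := by
  rw [ContinuousLinearMap.isSelfAdjoint_iff_isSymmetric]
  intro f g
  have h : ∀ ψ, schrodinger L V hV ψ = shift 1 ψ + shift (-1) ψ + mulPotential V hV ψ :=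
    fun _ => rfl
  change inner ℂ (schrodinger L V hV f) g = inner ℂ f (schrodinger L V hV g)
  rw [h, h, inner_add_left, inner_add_left, inner_add_right, inner_add_right, inner_shift,
    inner_shift, neg_neg]
  have : inner ℂ (mulPotential V hV f) g = inner ℂ f (mulPotential V hV g) := by
    rw [lp.inner_eq_tsum, lp.inner_eq_tsum]
    congr 1
    ext n
    change inner ℂ ((V n : ℂ) * f n) (g n) = inner ℂ (f n) ((V n : ℂ) * g n)
    simp
    ring
  rw [this]
  ring

theorem norm_le_of_spectrum {H : Ell2 L →L[ℂ] Ell2 L} (hH : IsSelfAdjoint H) {R : ℝ} (hR : 0 ≤ R)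
    (hspec : spectrum ℂ H ⊆ (fun x : ℝ => (x : ℂ)) '' Icc (-R) R) : ‖H‖ ≤ R := by
  have h := hH.spectralRadius_eq_nnnorm
  have h2 : spectralRadius ℂ H ≤ ENNReal.ofReal R := by
    unfold spectralRadius
    refine iSup₂_le fun k hk => ?_
    obtain ⟨x, hx, rfl⟩ := hspec hk
    rw [← ENNReal.ofReal_coe_nnreal]
    refine ENNReal.ofReal_le_ofReal ?_
    simpa using abs_le.2 hx
  rw [h, ← ENNReal.ofReal_coe_nnreal, coe_nnnorm] at h2
  exact (ENNReal.ofReal_le_ofReal_iff hR).1 h2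

theorem im_mul_norm_sq_le {H : Ell2 L →L[ℂ] Ell2 L} (hH : IsSelfAdjoint H) (z : ℂ)
    (v : Ell2 L) : z.im * ‖v‖ ^ 2 ≤ ‖inner ℂ v (H v - z • v)‖ := by
  have h1 : (inner ℂ v (H v)).im = 0 := by
    have := (ContinuousLinearMap.isSelfAdjoint_iff_isSymmetric.1 hH).im_inner_self_apply v
    simpa using this
  have h2 : (inner ℂ v (H v - z • v)).im = -(z.im * ‖v‖ ^ 2) := by
    rw [inner_sub_right, inner_smul_right, inner_self_eq_norm_sq_to_K, Complex.sub_im, h1]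
    simp [Complex.mul_im, ← Complex.ofReal_pow]
  have h3 := Complex.abs_im_le_norm (inner ℂ v (H v - z • v))
  rw [h2, abs_neg] at h3
  exact (le_abs_self _).trans h3

theorem sub_norm_mul_norm_sq_le {H : Ell2 L →L[ℂ] Ell2 L} {R : ℝ} (hR : ‖H‖ ≤ R) (z : ℂ)
    (v : Ell2 L) : (‖z‖ - R) * ‖v‖ ^ 2 ≤ ‖inner ℂ v (H v - z • v)‖ := by
  have h1 : ‖inner ℂ v (H v)‖ ≤ R * ‖v‖ ^ 2 :=
    calc _ ≤ ‖v‖ * ‖H v‖ := norm_inner_le_norm _ _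
      _ ≤ ‖v‖ * (R * ‖v‖) := by
        gcongr
        exact H.le_of_opNorm_le hR v
      _ = _ := by ring
  rw [inner_sub_right, inner_smul_right, inner_self_eq_norm_sq_to_K]
  have h2 := norm_sub_norm_le (z * ((‖v‖ : ℂ)) ^ 2) (inner ℂ v (H v))
  rw [norm_sub_rev] at h2
  have h3 : ‖z * ((‖v‖ : ℂ)) ^ 2‖ = ‖z‖ * ‖v‖ ^ 2 := by simp
  rw [h3] at h2
  refine le_trans ?_ h2
  linarith

/-! ### Restriction to a half-line -/

/-- The restriction of `ψ` to the half-line on the side `σ`, with boundary value `0`. -/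
noncomputable def restr (σ : Bool) (ψ : Ell2 L) (j : ℕ) : ℂ :=
  if j = 0 then 0 else val ψ (reflect σ j)

theorem restr_succ (σ : Bool) (ψ : Ell2 L) (j : ℕ) :
    restr σ ψ (j + 1) = val ψ (reflect σ ((j : ℤ) + 1)) := by
  simp [restr]

theorem summable_val_sq (ψ : Ell2 L) : Summable fun n : ℤ => ‖val ψ n‖ ^ 2 := by
  have h := (hasSum_norm_sq ψ).summable
  have e : ∀ n : L.sites, ‖ψ n‖ ^ 2 = (fun n : ℤ => ‖val ψ n‖ ^ 2) n := fun n => by simp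
  simp only [e] at h
  refine (hasSum_subtype_iff_of_support_subset ?_).1 h.hasSum |>.summable
  intro n hn
  by_contra h
  simp [val_of_notMem ψ h] at hn

theorem tsum_val_sq (ψ : Ell2 L) : ∑' n : ℤ, ‖val ψ n‖ ^ 2 = ‖ψ‖ ^ 2 := by
  rw [← (hasSum_norm_sq ψ).tsum_eq]
  have e : ∀ n : L.sites, ‖ψ n‖ ^ 2 = (fun n : ℤ => ‖val ψ n‖ ^ 2) n := fun n => by simp
  simp only [e]
  refine (tsum_subtype_eq_of_support_subset (f := fun n : ℤ => ‖val ψ n‖ ^ 2) ?_).symm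
  intro n hn
  by_contra h
  simp [val_of_notMem ψ h] at hn

theorem reflect_succ_injective (σ : Bool) :
    Function.Injective fun j : ℕ => reflect σ ((j : ℤ) + 1) := fun a b h => by
  simpa using reflect_injective σ h

theorem summable_restr (σ : Bool) (ψ : Ell2 L) : Summable fun j => ‖restr σ ψ j‖ ^ 2 := by
  rw [← summable_nat_add_iff 1]
  simp only [restr_succ]
  exact (summable_val_sq ψ).comp_injective (reflect_succ_injective σ)

theorem tailSq_restr_le (σ : Bool) (ψ : Ell2 L) : tailSq (restr σ ψ) 1 ≤ ‖ψ‖ ^ 2 := by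
  rw [← tsum_val_sq, tailSq]
  simp only [restr_succ]
  exact tsum_comp_le_tsum_of_inj (summable_val_sq ψ) (fun _ => by positivity)
    (reflect_succ_injective σ)

theorem norm_val_le (ψ : Ell2 L) (n : ℤ) : ‖val ψ n‖ ≤ ‖ψ‖ := by
  refine le_of_sq_le_sq ?_ (norm_nonneg _)
  rw [← tsum_val_sq]
  exact (summable_val_sq ψ).le_tsum n fun _ _ => by positivity

/-- A square-summable Dirichlet sequence, transplanted to the half-line on the side `σ`. -/
theorem exists_extend (σ : Bool) (hσ : ∀ n, 1 ≤ n → reflect σ n ∈ L.sites) {f : ℕ → ℂ}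
    (h0 : f 0 = 0) (hf : Summable fun j => ‖f j‖ ^ 2) :
    ∃ v : Ell2 L, (∀ n, val v n = f (reflect σ n).toNat) ∧ ‖v‖ ^ 2 = ∑' j, ‖f j‖ ^ 2 := by
  have hz : ∀ n, n ∉ range (fun j : ℕ => reflect σ ((j : ℤ) + 1)) →
      f (reflect σ n).toNat = 0 := fun n hn => by
    by_cases h : 1 ≤ reflect σ n
    · refine absurd ⟨(reflect σ n).toNat - 1, ?_⟩ hn
      have : ((((reflect σ n).toNat - 1 : ℕ) : ℤ) + 1) = reflect σ n := by omega
      simp only [this, reflect_reflect]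
    · rw [Int.toNat_of_nonpos (by omega), h0]
  have hz2 : ∀ n, n ∉ L.sites → f (reflect σ n).toNat = 0 := fun n hn => hz n (by
    rintro ⟨j, rfl⟩
    exact hn (hσ _ (by omega)))
  have e1 : ∀ j : ℕ, f (reflect σ (reflect σ ((j : ℤ) + 1))).toNat = f (j + 1) := fun j => by
    rw [reflect_reflect]
    congr 1
  have hs : HasSum (fun n : ℤ => ‖f (reflect σ n).toNat‖ ^ 2) (∑' j, ‖f j‖ ^ 2) := by
    rw [← (reflect_succ_injective σ).hasSum_iff (fun n hn => by simp [hz n hn])]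
    have : ((fun n : ℤ => ‖f (reflect σ n).toNat‖ ^ 2) ∘ fun j : ℕ => reflect σ ((j : ℤ) + 1))
        = fun j => ‖f (j + 1)‖ ^ 2 := by
      ext j
      simp only [Function.comp, e1]
    rw [this, hasSum_nat_add_iff (f := fun j => ‖f j‖ ^ 2) 1]
    simpa [h0] using hf.hasSum
  have hm : Memℓp (fun n : L.sites => f (reflect σ n).toNat) 2 := by
    refine memℓp_gen ?_
    have := hs.summable.comp_injective (Subtype.val_injective (p := (· ∈ L.sites)))
    simpa [Function.comp_def] using this
  have hval : ∀ n, val (⟨_, hm⟩ : Ell2 L) n = f (reflect σ n).toNat := fun n => by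
    by_cases h : n ∈ L.sites
    · exact val_of_mem _ h
    · rw [val_of_notMem _ h, hz2 n h]
  refine ⟨⟨_, hm⟩, hval, ?_⟩
  rw [← tsum_val_sq]
  simp only [hval]
  exact hs.tsum_eq

variable {V : ℤ → ℝ} {hV : IsBoundedPotential L V}

/-- Value of `(H - z) ψ` at a site of the half-line on the side `σ`. -/
theorem schrodinger_sub_apply (z : ℂ) (ψ : Ell2 L) (σ : Bool) (k : ℤ)
    (hk : reflect σ (k + 1) ∈ L.sites) :
    (schrodinger L V hV ψ - z • ψ) ⟨reflect σ (k + 1), hk⟩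
      = val ψ (reflect σ (k + 2)) + val ψ (reflect σ k)
        + ((V (reflect σ (k + 1)) : ℂ) - z) * val ψ (reflect σ (k + 1)) := by
  change schrodinger L V hV ψ ⟨_, hk⟩ - z * ψ ⟨_, hk⟩ = _
  rw [schrodinger_apply, ← val_of_mem ψ hk]
  cases σ with
  | true =>
    simp only [reflect_true]
    rw [show k + 1 + 1 = k + 2 by ring, show k + 1 - 1 = k by ring]
    ring
  | false =>
    simp only [reflect_false]
    rw [show 1 - (k + 1) + 1 = 1 - k by ring, show 1 - (k + 1) - 1 = 1 - (k + 2) by ring]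
    ring

/-- A lower bound for the quadratic form of `H - z` passes to the half-lines: the coupling to the
other half-line is paired with a site where the function vanishes. -/
theorem formBound_of_inner {z : ℂ} {d : ℝ} (σ : Bool) (hσ : ∀ n, 1 ≤ n → reflect σ n ∈ L.sites)
    (h : ∀ v : Ell2 L, d * ‖v‖ ^ 2 ≤ ‖inner ℂ v (schrodinger L V hV v - z • v)‖) :
    FormBound (fun k => V (reflect σ k)) z d := by
  intro f h0 hf k hk
  obtain ⟨v, hv, hn⟩ := exists_extend σ hσ h0 hf
  rw [← hn]
  refine (h v).trans (le_of_eq ?_)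
  rw [lp.inner_eq_tsum, tsum_eq_single ⟨reflect σ ((k : ℤ) + 1), hσ _ (by omega)⟩]
  · rw [RCLike.inner_apply, norm_mul, RCLike.norm_conj, mul_comm, schrodinger_sub_apply]
    congr 1
    · rw [← val_of_mem, hv, reflect_reflect]
      rfl
    · unfold residual
      simp only [hv, reflect_reflect]
      rfl
  · rintro ⟨n, hmem⟩ hne
    obtain ⟨m, rfl⟩ : ∃ m, n = reflect σ m := ⟨reflect σ n, (reflect_reflect σ n).symm⟩
    rw [RCLike.inner_apply]
    by_cases hm : 1 ≤ m
    · obtain ⟨j, rfl⟩ : ∃ j : ℕ, m = (j : ℤ) + 1 := ⟨(m - 1).toNat, by omega⟩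
      have hj : j ≠ k := fun h => hne (by subst h; rfl)
      rcases hk j hj with h1 | h1
      · have : v ⟨_, hmem⟩ = 0 := by
          rw [← val_of_mem, hv, reflect_reflect]
          exact h1
        rw [this]; simp
      · rw [schrodinger_sub_apply]
        simp only [hv, reflect_reflect]
        unfold residual at h1
        have h2 : f ((j : ℤ) + 2).toNat + f (j : ℤ).toNat
            + ((V (reflect σ ((j : ℤ) + 1)) : ℂ) - z) * f ((j : ℤ) + 1).toNat = 0 := h1
        rw [h2, zero_mul]
    · have : v ⟨_, hmem⟩ = 0 := by
        rw [← val_of_mem, hv, reflect_reflect, Int.toNat_of_nonpos (by omega), h0]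
      rw [this]; simp

theorem norm_delta_apply_le (n m : L.sites) : ‖(delta n : Ell2 L) m‖ ≤ 1 := by
  classical
  unfold delta
  by_cases h : m = n
  · subst h; simp [lp.single_apply]
  · simp [lp.single_apply, h]

theorem delta_apply_ne {n m : L.sites} (h : m ≠ n) : (delta n : Ell2 L) m = 0 := by
  classical
  simp [delta, lp.single_apply, h]

theorem norm_delta (n : L.sites) : ‖(delta n : Ell2 L)‖ = 1 := by
  classical
  simp [delta, lp.norm_single]

/-- The solution of `(H - z) u = δ₁` restricts to half-line solutions with a source at the
boundary. -/
theorem isGreen_restr {z : ℂ} {u : Ell2 L} (σ : Bool) (hσ : ∀ n, 1 ≤ n → reflect σ n ∈ L.sites)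
    (hu : schrodinger L V hV u - z • u = delta (siteOne L)) :
    ∃ c, ‖c‖ ≤ 1 + ‖u‖ ∧ IsGreen (fun k => V (reflect σ k)) z c (restr σ u) := by
  refine ⟨_, ?_, ⟨by simp [restr], summable_restr σ u, rfl, fun k => ?_⟩⟩
  · have h := schrodinger_sub_apply (hV := hV) z u σ 0 (hσ _ (by omega))
    rw [hu] at h
    have e : residual (fun k => V (reflect σ k)) z (restr σ u) 0
        = (delta (siteOne L) : Ell2 L) ⟨reflect σ (0 + 1), hσ _ (by omega)⟩
          - val u (reflect σ 0) := by
      rw [h]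
      simp [residual, restr]
      ring
    rw [e]
    exact (norm_sub_le _ _).trans (add_le_add (norm_delta_apply_le _ _) (norm_val_le _ _))
  · have hne : (⟨reflect σ (((k : ℤ) + 1) + 1), hσ _ (by omega)⟩ : L.sites) ≠ siteOne L := by
      intro h
      have h2 : reflect σ (((k : ℤ) + 1) + 1) = 1 := congrArg Subtype.val h
      cases σ <;> simp at h2 <;> omega
    have h := schrodinger_sub_apply (hV := hV) z u σ ((k : ℤ) + 1) (hσ _ (by omega))
    rw [hu, delta_apply_ne hne] at h
    rw [h]
    simp [residual, restr]

theorem norm_green_le {z : ℂ} {u : Ell2 L} {d : ℝ} (hd : 0 < d)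
    (hform : d * ‖u‖ ^ 2 ≤ ‖inner ℂ u (schrodinger L V hV u - z • u)‖)
    (hu : schrodinger L V hV u - z • u = delta (siteOne L)) : ‖u‖ ≤ 1 / d := by
  rw [hu] at hform
  have h := hform.trans (norm_inner_le_norm _ _)
  rw [norm_delta, mul_one] at h
  rcases (norm_nonneg u).eq_or_lt with h0 | h0
  · rw [← h0]; positivity
  · rw [le_div_iff₀ hd]
    nlinarith

end

section

/-! ### Plancherel's theorem for integrable square-integrable functions -/

open FourierTransform SchwartzMap in
/-- On `L¹ ∩ L²` the Fourier transform of `L²` is given by the Fourier integral: both agree as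
tempered distributions. -/
theorem fourier_toLp_ae_eq {f : ℝ → ℂ} (h1 : Integrable f) (h2 : MemLp f 2) :
    ((𝓕 (h2.toLp f) : Lp ℂ 2 (volume : Measure ℝ)) : ℝ → ℂ) =ᵐ[volume] 𝓕 f := by
  have hcont : Continuous (𝓕 f) :=
    VectorFourier.fourierIntegral_continuous Real.continuous_fourierChar
      continuous_inner h1
  refine ae_eq_of_integral_contDiff_smul_eq
    ((Lp.memLp _).locallyIntegrable one_le_two) hcont.locallyIntegrable fun g hg hgc => ?_
  have hg₁ : HasCompactSupport (Complex.ofRealCLM ∘ g) := hgc.comp_left rfl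
  have hg₂ := Complex.ofRealCLM.contDiff.comp hg
  set G : 𝓢(ℝ, ℂ) := hg₁.toSchwartzMap hg₂ with hG
  have e1 := DFunLike.congr_fun (Lp.fourier_toTemperedDistribution_eq (h2.toLp f)) G
  rw [TemperedDistribution.fourier_apply, Lp.toTemperedDistribution_apply,
    Lp.toTemperedDistribution_apply] at e1
  have e2 : ∫ x, (𝓕 G) x • (h2.toLp f : ℝ → ℂ) x = ∫ x, (𝓕 G) x • f x :=
    integral_congr_ae (by
      filter_upwards [h2.coeFn_toLp] with x hx
      rw [hx])
  have e3 : ∫ x, (𝓕 (G : ℝ → ℂ)) x • f x = ∫ x, G x • 𝓕 f x := by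
    have h := VectorFourier.integral_fourierIntegral_smul_eq_flip (μ := volume) (ν := volume)
      (L := innerₗ ℝ) Real.continuous_fourierChar continuous_inner G.integrable h1
    rwa [flip_innerₗ] at h
  have e4 : ∀ (F : ℝ → ℂ), ∫ x, g x • F x = ∫ x, G x • F x := fun F => by
    simp [hG]
  rw [e4, e4, ← e1, e2, ← e3]
  rfl

open FourierTransform in
theorem lintegral_fourier_sq {f : ℝ → ℂ} (h1 : Integrable f) (h2 : MemLp f 2) :
    ∫⁻ ξ, ‖𝓕 f ξ‖ₑ ^ 2 = ∫⁻ x, ‖f x‖ₑ ^ 2 := by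
  have key : ∀ F : ℝ → ℂ, ∫⁻ x, ‖F x‖ₑ ^ 2 = eLpNorm F 2 volume ^ 2 := fun F => by
    have := eLpNorm_nnreal_pow_eq_lintegral (μ := (volume : Measure ℝ)) (f := F)
      (p := 2) two_ne_zero
    simpa using this.symm
  rw [key, key, ← eLpNorm_congr_ae (fourier_toLp_ae_eq h1 h2), ← eLpNorm_congr_ae h2.coeFn_toLp]
  have := Lp.norm_fourier_eq (h2.toLp f)
  rw [Lp.norm_def, Lp.norm_def, ENNReal.toReal_eq_toReal_iff' (Lp.eLpNorm_ne_top _)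
    (Lp.eLpNorm_ne_top _)] at this
  rw [this]

/-! ### The resolvent as a Laplace transform of the evolution -/

variable {L : Lattice} {H : Ell2 L →L[ℂ] Ell2 L}

theorem norm_evolution (hH : IsSelfAdjoint H) (t : ℝ) (ψ : Ell2 L) :
    ‖evolution H t ψ‖ = ‖ψ‖ := by
  let : NormedAlgebra ℚ (Ell2 L →L[ℂ] Ell2 L) := NormedAlgebra.restrictScalars ℚ ℂ _
  refine ContinuousLinearMap.norm_map_of_mem_unitary ?_ ψ
  refine NormedSpace.exp_mem_unitary_of_mem_skewAdjoint ?_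
  rw [skewAdjoint.mem_iff, star_smul, hH.star_eq, ← neg_smul]
  simp

theorem hasDerivAt_evolution (H : Ell2 L →L[ℂ] Ell2 L) (t : ℝ) (ψ : Ell2 L) :
    HasDerivAt (fun s : ℝ => evolution H s ψ) (-Complex.I • H (evolution H t ψ)) t := by
  have h := (hasDerivAt_exp_smul_const' (𝕂 := ℂ) (-Complex.I • H) (t : ℂ)).scomp t
    Complex.ofRealCLM.hasDerivAt
  have h2 := ((ContinuousLinearMap.apply ℂ (Ell2 L) ψ).restrictScalars
    ℝ).hasFDerivAt.comp_hasDerivAt t h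
  have e : ∀ s : ℝ, evolution H s = NormedSpace.exp ((s : ℂ) • -Complex.I • H) := fun s => by
    rw [evolution, smul_smul]
    congr 2
    ring
  simp only [e]
  refine h2.congr_deriv ?_
  simp

theorem continuous_evolution (H : Ell2 L →L[ℂ] Ell2 L) (ψ : Ell2 L) :
    Continuous fun t : ℝ => evolution H t ψ :=
  continuous_iff_continuousAt.2 fun t => (hasDerivAt_evolution H t ψ).continuousAt

/-- The wave packet `e^{izt} e^{-itH} δ₁`. -/
noncomputable def dampedState (H : Ell2 L →L[ℂ] Ell2 L) (z : ℂ) (t : ℝ) : Ell2 L :=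
  Complex.exp (Complex.I * z * t) • evolution H t (delta (siteOne L))

/-- The resolvent vector `(H - z)⁻¹ δ₁`, for `Im z > 0`, as a Laplace transform. -/
noncomputable def greenVec (H : Ell2 L →L[ℂ] Ell2 L) (z : ℂ) : Ell2 L :=
  Complex.I • ∫ t in Ioi (0 : ℝ), dampedState H z t

theorem norm_dampedState (hH : IsSelfAdjoint H) (z : ℂ) (t : ℝ) :
    ‖dampedState H z t‖ = Real.exp (-z.im * t) := by
  rw [dampedState, norm_smul, norm_evolution hH, norm_delta, mul_one, Complex.norm_exp]
  simp

theorem continuous_dampedState (H : Ell2 L →L[ℂ] Ell2 L) (z : ℂ) :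
    Continuous (dampedState H z) := by
  unfold dampedState
  have := continuous_evolution H (delta (siteOne L))
  fun_prop

theorem integrableOn_dampedState (hH : IsSelfAdjoint H) {z : ℂ} (hz : 0 < z.im) :
    IntegrableOn (dampedState H z) (Ioi 0) := by
  refine (integrableOn_exp_mul_Ioi (a := -z.im) (by linarith) 0).mono'
    (continuous_dampedState H z).aestronglyMeasurable ?_
  exact Eventually.of_forall fun t => (norm_dampedState hH z t).le

theorem greenVec_spec (hH : IsSelfAdjoint H) {z : ℂ} (hz : 0 < z.im) :
    H (greenVec H z) - z • greenVec H z = delta (siteOne L) := by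
  set A : Ell2 L →L[ℂ] Ell2 L := -Complex.I • (H - z • ContinuousLinearMap.id ℂ (Ell2 L)) with hA
  have hder : ∀ t, HasDerivAt (dampedState H z) (A (dampedState H z t)) t := fun t => by
    have h1 : HasDerivAt (fun s : ℝ => Complex.exp (Complex.I * z * s))
        (Complex.exp (Complex.I * z * t) * (Complex.I * z)) t := by
      have : HasDerivAt (fun s : ℂ => Complex.I * z * s) (Complex.I * z) (t : ℂ) := by
        simpa using (hasDerivAt_id (t : ℂ)).const_mul (Complex.I * z)
      exact this.cexp.comp_ofReal
    have h2 := h1.smul (hasDerivAt_evolution H t (delta (siteOne L)))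
    refine h2.congr_deriv ?_
    simp only [hA, dampedState, _root_.smul_apply, _root_.sub_apply,
      ContinuousLinearMap.id_apply, map_smul]
    module
  have hint := integrableOn_dampedState hH hz
  have hlim : Tendsto (dampedState H z) atTop (𝓝 0) := by
    rw [tendsto_zero_iff_norm_tendsto_zero]
    simp only [norm_dampedState hH]
    exact Real.tendsto_exp_atBot.comp
      (tendsto_id.const_mul_atTop_of_neg (by linarith : -z.im < 0))
  have h := integral_Ioi_of_hasDerivAt_of_tendsto' (a := 0) (fun t _ => hder t)
    (A.integrable_comp hint) hlim
  rw [A.integral_comp_comm hint] at h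
  have h0 : dampedState H z 0 = delta (siteOne L) := by
    simp [dampedState, evolution]
  rw [h0, zero_sub, hA] at h
  have h3 := congrArg (fun x => -x) h
  simp only [neg_neg] at h3
  rw [← h3, greenVec]
  simp only [_root_.smul_apply, _root_.sub_apply,
    ContinuousLinearMap.id_apply, map_smul]
  module

/-- The time-damped amplitude at the site `n`, extended by zero to negative times. -/
noncomputable def dampedAmp (H : Ell2 L →L[ℂ] Ell2 L) (n : L.sites) (T : ℝ) : ℝ → ℂ :=
  (Ioi (0 : ℝ)).indicator fun t =>
    Complex.exp (-(t / T : ℝ)) * evolution H t (delta (siteOne L)) n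

theorem continuous_coord (n : L.sites) : Continuous fun ψ : Ell2 L => ψ n :=
  (lp.evalCLM ℂ (fun _ : L.sites => ℂ) 2 n).continuous

theorem enorm_dampedAmp_sq (H : Ell2 L →L[ℂ] Ell2 L) (n : L.sites) (T t : ℝ) :
    ‖dampedAmp H n T t‖ₑ ^ 2 = (Ioi (0 : ℝ)).indicator (fun t => ENNReal.ofReal
      (Real.exp (-2 * t / T) * ‖evolution H t (delta (siteOne L)) n‖ ^ 2)) t := by
  unfold dampedAmp
  by_cases ht : t ∈ Ioi (0 : ℝ)
  · rw [indicator_of_mem ht, indicator_of_mem ht, ← ofReal_norm,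
      ← ENNReal.ofReal_pow (norm_nonneg _), norm_mul, mul_pow, Complex.norm_exp, ← Real.exp_nat_mul]
    congr 3
    simp
    ring
  · simp [indicator_of_notMem ht]

theorem norm_evolution_coord_le (hH : IsSelfAdjoint H) (n : L.sites) (t : ℝ) :
    ‖evolution H t (delta (siteOne L)) n‖ ≤ 1 := by
  have := norm_val_le (evolution H t (delta (siteOne L))) n
  rwa [val_coe, norm_evolution hH, norm_delta] at this

theorem continuous_evolution_coord (H : Ell2 L →L[ℂ] Ell2 L) (n : L.sites) :
    Continuous fun t : ℝ => evolution H t (delta (siteOne L)) n :=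
  (continuous_coord n).comp (continuous_evolution H (delta (siteOne L)))

theorem integrable_dampedAmp (hH : IsSelfAdjoint H) (n : L.sites) {T : ℝ} (hT : 0 < T) :
    Integrable (dampedAmp H n T) := by
  unfold dampedAmp
  rw [integrable_indicator_iff measurableSet_Ioi]
  have hc := continuous_evolution_coord H n
  refine (integrableOn_exp_mul_Ioi (a := -(1 / T)) (by simpa using hT) 0).mono' ?_ ?_
  · exact Continuous.aestronglyMeasurable (by fun_prop)
  · refine Eventually.of_forall fun t => ?_
    rw [norm_mul, Complex.norm_exp]
    refine (mul_le_of_le_one_right (by positivity) (norm_evolution_coord_le hH n t)).trans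
      (le_of_eq ?_)
    congr 1
    simp
    ring

theorem integrableOn_damped_sq (hH : IsSelfAdjoint H) (n : L.sites) {T : ℝ} (hT : 0 < T) :
    IntegrableOn (fun t => Real.exp (-2 * t / T) * ‖evolution H t (delta (siteOne L)) n‖ ^ 2)
      (Ioi 0) := by
  have hc := continuous_evolution_coord H n
  refine (integrableOn_exp_mul_Ioi (a := -(2 / T)) (by simpa using hT) 0).mono' ?_ ?_
  · exact Continuous.aestronglyMeasurable (by fun_prop)
  · refine Eventually.of_forall fun t => ?_
    rw [Real.norm_of_nonneg (by positivity)]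
    refine (mul_le_of_le_one_right (by positivity) (pow_le_one₀ (norm_nonneg _)
      (norm_evolution_coord_le hH n t))).trans (le_of_eq ?_)
    congr 1
    ring

theorem lintegral_dampedAmp_sq (hH : IsSelfAdjoint H) (n : L.sites) {T : ℝ} (hT : 0 < T) :
    ∫⁻ t, ‖dampedAmp H n T t‖ₑ ^ 2 = ENNReal.ofReal (T / 2 * avgProb H n T) := by
  simp only [enorm_dampedAmp_sq]
  rw [lintegral_indicator measurableSet_Ioi,
    ← ofReal_integral_eq_lintegral_ofReal (integrableOn_damped_sq hH n hT)
      (Eventually.of_forall fun t => by positivity)]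
  congr 1
  have e : ∀ t, ‖inner ℂ (evolution H t (delta (siteOne L))) (delta n)‖
      = ‖evolution H t (delta (siteOne L)) n‖ := fun t => by
    classical
    unfold delta
    rw [lp.inner_single_right]
    simp
  unfold avgProb
  simp only [e]
  field_simp

theorem memLp_dampedAmp (hH : IsSelfAdjoint H) (n : L.sites) {T : ℝ} (hT : 0 < T) :
    MemLp (dampedAmp H n T) 2 := by
  refine ⟨(integrable_dampedAmp hH n hT).aestronglyMeasurable, ?_⟩
  have h := eLpNorm_nnreal_pow_eq_lintegral (μ := (volume : Measure ℝ)) (f := dampedAmp H n T)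
    (p := 2) two_ne_zero
  have h2 : eLpNorm (dampedAmp H n T) 2 volume ^ 2 = ENNReal.ofReal (T / 2 * avgProb H n T) := by
    rw [← lintegral_dampedAmp_sq hH n hT]
    simpa using h
  have : eLpNorm (dampedAmp H n T) 2 volume ^ 2 < ⊤ := h2 ▸ ENNReal.ofReal_lt_top
  simpa using this

open FourierTransform in
theorem greenVec_coord (hH : IsSelfAdjoint H) (n : L.sites) {T : ℝ} (hT : 0 < T) (E : ℝ) :
    greenVec H ((E : ℂ) + Complex.I / (T : ℂ)) n
      = Complex.I * 𝓕 (dampedAmp H n T) (-(2 * Real.pi)⁻¹ * E) := by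
  have hz : 0 < ((E : ℂ) + Complex.I / (T : ℂ)).im := by
    simpa [Complex.div_ofReal_im] using hT
  have h := (lp.evalCLM ℂ (fun _ : L.sites => ℂ) 2 n).integral_comp_comm
    (integrableOn_dampedState hH hz)
  change (∫ t in Ioi (0 : ℝ), dampedState H ((E : ℂ) + Complex.I / (T : ℂ)) t n) = _ at h
  change Complex.I * (lp.evalCLM ℂ (fun _ : L.sites => ℂ) 2 n)
    (∫ t in Ioi (0 : ℝ), dampedState H ((E : ℂ) + Complex.I / (T : ℂ)) t) = _
  rw [← h, Real.fourier_real_eq_integral_exp_smul, ← integral_indicator measurableSet_Ioi]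
  congr 2
  ext t
  unfold dampedAmp
  by_cases ht : t ∈ Ioi (0 : ℝ)
  · rw [indicator_of_mem ht, indicator_of_mem ht]
    change Complex.exp _ * _ = Complex.exp _ * _
    rw [← mul_assoc, ← Complex.exp_add]
    congr 2
    have hpi : (Real.pi : ℂ) ≠ 0 := by exact_mod_cast Real.pi_ne_zero
    have hT' : (T : ℂ) ≠ 0 := by exact_mod_cast hT.ne'
    push_cast
    field_simp
    linear_combination (t : ℂ) * Complex.I_sq
  · simp [indicator_of_notMem ht]

theorem lintegral_comp_mul {a : ℝ} (ha : a ≠ 0) {F : ℝ → ℝ≥0∞} (hF : Measurable F) :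
    ∫⁻ x, F (a * x) = ENNReal.ofReal |a⁻¹| * ∫⁻ x, F x := by
  rw [← lintegral_map hF (measurable_const_mul a), Real.map_volume_mul_left ha,
    lintegral_smul_measure, smul_eq_mul]

/-- Time averages as energy integrals of the resolvent:
`a(n,T) = (πT)⁻¹ ∫ |⟨(H - E - i/T)⁻¹ δ₁, δ_n⟩|² dE`. -/
theorem ofReal_avgProb (hH : IsSelfAdjoint H) (n : L.sites) {T : ℝ} (hT : 0 < T) :
    ENNReal.ofReal (avgProb H n T) = ENNReal.ofReal (Real.pi * T)⁻¹ *
      ∫⁻ E : ℝ, ‖greenVec H ((E : ℂ) + Complex.I / (T : ℂ)) n‖ₑ ^ 2 := by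
  have hcont : Continuous (FourierTransform.fourier (dampedAmp H n T) : ℝ → ℂ) :=
    VectorFourier.fourierIntegral_continuous Real.continuous_fourierChar continuous_inner
      (integrable_dampedAmp hH n hT)
  have e : ∀ E : ℝ, ‖greenVec H ((E : ℂ) + Complex.I / (T : ℂ)) n‖ₑ ^ 2
      = (fun x => ‖(FourierTransform.fourier (dampedAmp H n T) : ℝ → ℂ) x‖ₑ ^ 2)
        (-(2 * Real.pi)⁻¹ * E) := fun E => by
    rw [greenVec_coord hH n hT, enorm_mul]
    simp [enorm_eq_nnnorm]
  have hpi := Real.pi_pos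
  rw [lintegral_congr e, lintegral_comp_mul (by simp [hpi.ne'])
    (F := fun x => ‖(FourierTransform.fourier (dampedAmp H n T) : ℝ → ℂ) x‖ₑ ^ 2)
    (hcont.enorm.measurable.pow_const 2), lintegral_fourier_sq
    (integrable_dampedAmp hH n hT) (memLp_dampedAmp hH n hT), lintegral_dampedAmp_sq hH n hT,
    ← ENNReal.ofReal_mul (by positivity), ← ENNReal.ofReal_mul (by positivity)]
  congr 1
  rw [inv_neg, inv_inv, abs_neg, abs_of_pos (by positivity)]
  field_simp

theorem tsum_enorm_sq (ψ : Ell2 L) : ∑' n, ‖ψ n‖ₑ ^ 2 = ENNReal.ofReal (‖ψ‖ ^ 2) := by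
  rw [← (hasSum_norm_sq ψ).tsum_eq,
    ENNReal.ofReal_tsum_of_nonneg (fun _ => by positivity) (hasSum_norm_sq ψ).summable]
  congr 1
  ext n
  rw [← ofReal_norm, ENNReal.ofReal_pow (norm_nonneg _)]

/-- Conservation of probability. -/
theorem tsum_ofReal_avgProb (hH : IsSelfAdjoint H) {T : ℝ} (hT : 0 < T) :
    ∑' n, ENNReal.ofReal (avgProb H n T) = 1 := by
  have hmeas : ∀ n : L.sites, Measurable fun t : ℝ => ENNReal.ofReal
      (Real.exp (-2 * t / T) * ‖evolution H t (delta (siteOne L)) n‖ ^ 2) := fun n => by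
    have hc := continuous_evolution_coord H n
    exact (Continuous.measurable (by fun_prop)).ennreal_ofReal
  have h1 : ∑' n : L.sites, ∫⁻ t, ‖dampedAmp H n T t‖ₑ ^ 2 = ENNReal.ofReal (T / 2) := by
    simp only [enorm_dampedAmp_sq, lintegral_indicator measurableSet_Ioi]
    rw [← lintegral_tsum fun n => (hmeas n).aemeasurable]
    have e : ∀ t : ℝ, ∑' n : L.sites, ENNReal.ofReal
        (Real.exp (-2 * t / T) * ‖evolution H t (delta (siteOne L)) n‖ ^ 2)
        = ENNReal.ofReal (Real.exp (-(2 / T) * t)) := fun t => by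
      have hs := hasSum_norm_sq (evolution H t (delta (siteOne L)))
      rw [norm_evolution hH, norm_delta] at hs
      have hs2 := hs.mul_left (Real.exp (-2 * t / T))
      rw [← ENNReal.ofReal_tsum_of_nonneg (fun _ => by positivity) hs2.summable, hs2.tsum_eq]
      congr 1
      rw [one_pow, mul_one]
      congr 1
      ring
    simp only [e]
    have ha : -(2 / T) < 0 := by simpa using hT
    rw [← ofReal_integral_eq_lintegral_ofReal (integrableOn_exp_mul_Ioi ha 0)
      (Eventually.of_forall fun t => by positivity), integral_exp_mul_Ioi ha]
    congr 1
    simp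
  simp only [lintegral_dampedAmp_sq hH _ hT, ENNReal.ofReal_mul (by positivity : 0 ≤ T / 2)] at h1
  rw [ENNReal.tsum_mul_left] at h1
  have h0 : ENNReal.ofReal (T / 2) ≠ 0 := by simpa using hT
  exact (ENNReal.mul_right_inj h0 ENNReal.ofReal_ne_top).1 (h1.trans (mul_one _).symm)

theorem measurable_greenVec_coord (hH : IsSelfAdjoint H) (n : L.sites) {T : ℝ} (hT : 0 < T) :
    Measurable fun E : ℝ => ‖greenVec H ((E : ℂ) + Complex.I / (T : ℂ)) n‖ₑ ^ 2 := by
  have hcont : Continuous (FourierTransform.fourier (dampedAmp H n T) : ℝ → ℂ) :=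
    VectorFourier.fourierIntegral_continuous Real.continuous_fourierChar continuous_inner
      (integrable_dampedAmp hH n hT)
  simp only [greenVec_coord hH n hT]
  exact (continuous_const.mul
    (hcont.comp (continuous_const.mul continuous_id))).enorm.measurable.pow_const 2

/-- Conservation of probability, in terms of the resolvent. -/
theorem lintegral_norm_greenVec (hH : IsSelfAdjoint H) {T : ℝ} (hT : 0 < T) :
    ENNReal.ofReal (Real.pi * T)⁻¹ *
      ∫⁻ E : ℝ, ENNReal.ofReal (‖greenVec H ((E : ℂ) + Complex.I / (T : ℂ))‖ ^ 2) = 1 := by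
  rw [← tsum_ofReal_avgProb hH hT]
  simp only [ofReal_avgProb hH _ hT]
  rw [ENNReal.tsum_mul_left,
    ← lintegral_tsum fun n => (measurable_greenVec_coord hH n hT).aemeasurable]
  simp only [tsum_enorm_sq]

end

section

/-! ### Tails of the resolvent vector -/

variable {L : Lattice}

/-- The part `∑_{j ≥ n} |ψ(σ j)|²` of the mass of `ψ` on the side `σ`, with values in `[0,∞]`. -/
noncomputable def sideTail (σ : Bool) (ψ : Ell2 L) (n : ℕ) : ℝ≥0∞ :=
  ∑' m, ‖restr σ ψ (m + n)‖ₑ ^ 2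

theorem sideTail_eq (σ : Bool) (ψ : Ell2 L) (n : ℕ) :
    sideTail σ ψ n = ENNReal.ofReal (tailSq (restr σ ψ) n) := by
  rw [sideTail, tailSq, ENNReal.ofReal_tsum_of_nonneg (fun _ => by positivity)
    (summable_tail (summable_restr σ ψ) n)]
  congr 1
  ext m
  rw [← ofReal_norm, ENNReal.ofReal_pow (norm_nonneg _)]

/-- The side `σ` carries a half-line of sites: always for the right side, and on the line also for
the left side. -/
def HasSide (L : Lattice) (σ : Bool) : Prop := ∀ n, 1 ≤ n → reflect σ n ∈ L.sites

theorem sideTail_eq_zero {σ : Bool} (h : ¬ HasSide L σ) (ψ : Ell2 L) (n : ℕ) :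
    sideTail σ ψ n = 0 := by
  have hr : ∀ j, restr σ ψ j = 0 := fun j => by
    cases L with
    | line => exact absurd (fun n _ => mem_univ _) h
    | halfLine =>
      cases σ with
      | true => exact absurd (fun n hn => hn) h
      | false =>
        rcases j with _ | j
        · simp [restr]
        · rw [restr_succ]
          refine val_of_notMem ψ fun h => ?_
          change (1 : ℤ) ≤ 1 - ((j : ℤ) + 1) at h
          omega
  simp [sideTail, hr]

theorem tsum_outside_le (ψ : Ell2 L) {N : ℝ} {M : ℕ} (hM : (M : ℝ) ≤ N) :
    ∑' n : {n : L.sites // N < |((n : ℤ) : ℝ)|}, ‖ψ n‖ₑ ^ 2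
      ≤ sideTail true ψ (M + 1) + sideTail false ψ (M + 1) := by
  have habs : ∀ n : {n : L.sites // N < |((n : ℤ) : ℝ)|}, (M : ℤ) < |((n : L.sites) : ℤ)| :=
    fun n => by
      have := hM.trans_lt n.2
      exact_mod_cast this
  let e : {n : L.sites // N < |((n : ℤ) : ℝ)|} → Bool × ℕ := fun n =>
    if 0 < ((n : L.sites) : ℤ) then (true, ((n : L.sites) : ℤ).toNat - (M + 1))
    else (false, (1 - ((n : L.sites) : ℤ)).toNat - (M + 1))
  have hval : ∀ n, ψ n.1 = restr (e n).1 ψ ((e n).2 + (M + 1)) := fun n => by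
    have h := habs n
    rw [← val_coe]
    simp only [e]
    split_ifs with h0
    · rw [abs_of_pos h0] at h
      have : ((n : L.sites) : ℤ).toNat - (M + 1) + (M + 1) = ((n : L.sites) : ℤ).toNat := by omega
      simp only [this, restr, reflect_true]
      rw [if_neg (by omega), Int.toNat_of_nonneg h0.le]
    · rw [abs_of_nonpos (not_lt.1 h0)] at h
      have : (1 - ((n : L.sites) : ℤ)).toNat - (M + 1) + (M + 1)
          = (1 - ((n : L.sites) : ℤ)).toNat := by omega
      simp only [this, restr, reflect_false]
      rw [if_neg (by omega), Int.toNat_of_nonneg (by omega), sub_sub_cancel]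
  have hinj : Function.Injective e := fun n m hnm => by
    have h1 := habs n
    have h2 := habs m
    refine Subtype.ext (Subtype.ext ?_)
    simp only [e] at hnm
    split_ifs at hnm with a b b <;>
      simp only [Prod.mk.injEq, true_and, reduceCtorEq, false_and] at hnm
    · rw [abs_of_pos a] at h1
      rw [abs_of_pos b] at h2
      omega
    · rw [abs_of_nonpos (not_lt.1 a)] at h1
      rw [abs_of_nonpos (not_lt.1 b)] at h2
      omega
  calc _ = ∑' n, (fun x : Bool × ℕ => ‖restr x.1 ψ (x.2 + (M + 1))‖ₑ ^ 2) (e n) := by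
        simp only [hval]
    _ ≤ ∑' x : Bool × ℕ, ‖restr x.1 ψ (x.2 + (M + 1))‖ₑ ^ 2 :=
        ENNReal.tsum_comp_le_tsum_of_injective hinj _
    _ = _ := by
        rw [ENNReal.tsum_prod (f := fun σ j => ‖restr σ ψ (j + (M + 1))‖ₑ ^ 2), tsum_bool, add_comm]
        rfl

variable {V : ℤ → ℝ} {hV : IsBoundedPotential L V} {z : ℂ} {u : Ell2 L} {d : ℝ}

/-- Exponential decay of the resolvent vector on each side. -/
theorem sideTail_decay (hu : schrodinger L V hV u - z • u = delta (siteOne L)) (hd : 0 ≤ d)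
    (h : ∀ v : Ell2 L, d * ‖v‖ ^ 2 ≤ ‖inner ℂ v (schrodinger L V hV v - z • v)‖)
    (σ : Bool) (k : ℕ) :
    sideTail σ u (2 * k + 1) ≤ ENNReal.ofReal (((1 + 2 * d) ^ k)⁻¹ * ‖u‖ ^ 2) := by
  by_cases hσ : HasSide L σ
  · obtain ⟨c, -, hc⟩ := isGreen_restr σ hσ hu
    have h1 := (hc.tail_decay hd (formBound_of_inner σ hσ h) k).trans (tailSq_restr_le σ u)
    rw [sideTail_eq]
    refine ENNReal.ofReal_le_ofReal ?_
    rw [inv_mul_eq_div, le_div_iff₀' (by positivity)]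
    exact h1
  · rw [sideTail_eq_zero hσ]
    exact zero_le

/-- The resolvent vector is small beyond a site where the transfer matrix is large. -/
theorem sideTail_mul_matNorm_le {T : ℝ} (hT : 1 ≤ T)
    (hu : schrodinger L V hV u - z • u = delta (siteOne L)) (hz : z.im = 1 / T)
    {σ : Bool} (hσ : HasSide L σ) {n M : ℕ} (hn : 1 ≤ n) (hnM : n ≤ M) :
    tailSq (restr σ u) (M + 1) * matNorm (transfer V (if σ then n else -n) z) ^ 2
      ≤ 32 * T ^ 6 := by
  have hT0 : 0 < T := by linarith
  have hform : ∀ v : Ell2 L, 1 / T * ‖v‖ ^ 2 ≤ ‖inner ℂ v (schrodinger L V hV v - z • v)‖ :=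
    fun v => hz ▸ im_mul_norm_sq_le (schrodinger_isSelfAdjoint L V hV) z v
  obtain ⟨c, hc1, hc⟩ := isGreen_restr σ hσ hu
  have hun := norm_green_le (by positivity) (hform u) hu
  rw [one_div_one_div] at hun
  have hc2 : ‖c‖ ^ 2 ≤ 4 * T ^ 2 := by
    have : ‖c‖ ≤ 2 * T := by linarith
    nlinarith [norm_nonneg c]
  have h1 := hc.tail_mul_entrySq_le (by positivity) ((div_le_one hT0).2 hT)
    (formBound_of_inner σ hσ hform) hn
  set A := tailSq (restr σ u) (n + 1) * entrySq (transferRight (fun k => V (reflect σ k)) z n)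
  have h2 : A ≤ 32 * T ^ 6 := by
    have h3 : A = T ^ 4 * ((1 / T) ^ 4 * A) := by field_simp
    rw [h3]
    calc T ^ 4 * ((1 / T) ^ 4 * A) ≤ T ^ 4 * (8 * ‖c‖ ^ 2) := by gcongr
      _ ≤ T ^ 4 * (8 * (4 * T ^ 2)) := by gcongr
      _ = _ := by ring
  refine le_trans ?_ h2
  exact mul_le_mul (tailSq_anti (summable_restr σ u) (by omega))
    (matNorm_transfer_sq_le V z σ hn) (by positivity) (tailSq_nonneg _ _)

/-! ### Energy integrals of inverse transfer matrices -/

/-- The sites at distance `1 ≤ n ≤ N` from the origin on the side `σ`. -/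
def sideSet (σ : Bool) (N : ℝ) : Set ℤ :=
  if σ then {n : ℤ | 1 ≤ n ∧ (n : ℝ) ≤ N} else {n : ℤ | 1 ≤ -n ∧ -(n : ℝ) ≤ N}

/-- The right or left integral of the inverse squared transfer matrices. -/
noncomputable def sideIntegral (V : ℤ → ℝ) (σ : Bool) (K N T : ℝ) : ℝ :=
  ∫ E in (-K)..K, (maxTransferSq V (sideSet σ N) ((E : ℂ) + Complex.I / (T : ℂ)))⁻¹

theorem exists_of_mem_sideSet {σ : Bool} {N : ℝ} {n : ℤ} (hn : n ∈ sideSet σ N) :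
    ∃ j : ℕ, 1 ≤ j ∧ (j : ℝ) ≤ N ∧ n = if σ then (j : ℤ) else -j := by
  cases σ with
  | true =>
    obtain ⟨h1, h2⟩ := (hn : 1 ≤ n ∧ (n : ℝ) ≤ N)
    lift n to ℕ using by omega
    exact ⟨n, by omega, by exact_mod_cast h2, by simp⟩
  | false =>
    obtain ⟨h1, h2⟩ := (hn : 1 ≤ -n ∧ -(n : ℝ) ≤ N)
    obtain ⟨m, rfl⟩ : ∃ m, n = -m := ⟨-n, by simp⟩
    rw [neg_neg] at h1
    lift m to ℕ using by omega
    exact ⟨m, by omega, by simpa using h2, by simp⟩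

theorem finite_sideSet (σ : Bool) (N : ℝ) : (sideSet σ N).Finite := by
  refine (Set.finite_Icc (-(⌊N⌋₊ : ℤ)) ⌊N⌋₊).subset fun n hn => ?_
  obtain ⟨j, -, h2, rfl⟩ := exists_of_mem_sideSet hn
  have := Nat.le_floor h2
  cases σ <;> simp <;> omega

theorem nonempty_sideSet (σ : Bool) {N : ℝ} (hN : 1 ≤ N) : (sideSet σ N).Nonempty := by
  cases σ with
  | true => exact ⟨1, by simpa [sideSet] using hN⟩
  | false => exact ⟨-1, by simpa [sideSet] using hN⟩

theorem exists_maxTransferSq_eq (V : ℤ → ℝ) {S : Set ℤ} (hS : S.Finite) (hS0 : S.Nonempty)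
    (z : ℂ) : ∃ n ∈ S, matNorm (transfer V n z) ^ 2 = maxTransferSq V S z :=
  (hS0.image _).csSup_mem (hS.image _)

theorem maxTransferSq_pos (V : ℤ → ℝ) {S : Set ℤ} (hS : S.Finite) (hS0 : S.Nonempty)
    (z : ℂ) : 0 < maxTransferSq V S z := by
  obtain ⟨n, -, hn⟩ := exists_maxTransferSq_eq V hS hS0 z
  rw [← hn]
  exact pow_pos (matNorm_transfer_pos V n z) 2

theorem continuous_maxTransferSq (V : ℤ → ℝ) {S : Set ℤ} (hS : S.Finite) (hS0 : S.Nonempty) :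
    Continuous (maxTransferSq V S) := by
  have h : maxTransferSq V S = fun z => hS.toFinset.sup' (by simpa using hS0)
      fun n => matNorm (transfer V n z) ^ 2 := by
    ext z
    rw [Finset.sup'_eq_csSup_image, Finite.coe_toFinset]
    rfl
  rw [h]
  refine Continuous.finset_sup'_apply _ fun n _ => ?_
  exact (continuous_matNorm_transfer V n).pow 2

theorem continuous_inv_maxTransferSq (V : ℤ → ℝ) {S : Set ℤ} (hS : S.Finite) (hS0 : S.Nonempty)
    (T : ℝ) : Continuous fun E : ℝ => (maxTransferSq V S ((E : ℂ) + Complex.I / (T : ℂ)))⁻¹ := by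
  refine Continuous.inv₀ ?_ fun E => (maxTransferSq_pos V hS hS0 _).ne'
  exact (continuous_maxTransferSq V hS hS0).comp (by fun_prop)

theorem measurable_sideTail_greenVec {H : Ell2 L →L[ℂ] Ell2 L} (hH : IsSelfAdjoint H) (σ : Bool)
    (n : ℕ) {T : ℝ} (hT : 0 < T) :
    Measurable fun E : ℝ => sideTail σ (greenVec H ((E : ℂ) + Complex.I / (T : ℂ))) n := by
  unfold sideTail
  refine Measurable.tsum fun m => ?_
  unfold restr
  split_ifs with h
  · simp
  · by_cases hm : reflect σ ((m + n : ℕ) : ℤ) ∈ L.sites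
    · simp only [val_of_mem _ hm]
      exact measurable_greenVec_coord hH _ hT
    · simp only [val_of_notMem _ hm]
      exact measurable_const

theorem energy_im (E T : ℝ) : ((E : ℂ) + Complex.I / (T : ℂ)).im = 1 / T := by
  simp [Complex.div_ofReal_im]

theorem abs_le_norm_energy (E T : ℝ) : |E| ≤ ‖(E : ℂ) + Complex.I / (T : ℂ)‖ := by
  have h := Complex.abs_re_le_norm ((E : ℂ) + Complex.I / (T : ℂ))
  simpa [Complex.div_ofReal_re] using h

theorem greenVec_energy_spec {H : Ell2 L →L[ℂ] Ell2 L} (hH : IsSelfAdjoint H) (E : ℝ) {T : ℝ}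
    (hT : 0 < T) : H (greenVec H ((E : ℂ) + Complex.I / (T : ℂ)))
      - ((E : ℂ) + Complex.I / (T : ℂ)) • greenVec H ((E : ℂ) + Complex.I / (T : ℂ))
      = delta (siteOne L) :=
  greenVec_spec hH (by rw [energy_im]; positivity)

theorem outsideProb_eq {H : Ell2 L →L[ℂ] Ell2 L} (hH : IsSelfAdjoint H) (N : ℝ) {T : ℝ}
    (hT : 0 < T) : outsideProb H N T = ENNReal.ofReal (Real.pi * T)⁻¹ *
      ∫⁻ E : ℝ, ∑' n : {n : L.sites // N < |((n : ℤ) : ℝ)|},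
        ‖greenVec H ((E : ℂ) + Complex.I / (T : ℂ)) n‖ₑ ^ 2 := by
  have h := lintegral_tsum (μ := (volume : Measure ℝ))
    (f := fun (n : {n : L.sites // N < |((n : ℤ) : ℝ)|}) (E : ℝ) =>
      ‖greenVec H ((E : ℂ) + Complex.I / (T : ℂ)) n‖ₑ ^ 2)
    fun n => (measurable_greenVec_coord hH n.1 hT).aemeasurable
  rw [h, ← ENNReal.tsum_mul_left]
  exact tsum_congr fun n => ofReal_avgProb hH n.1 hT

/-- Energies inside `[-K, K]`: the tail on a side is controlled by the transfer matrices. -/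
theorem lintegral_sideTail_Icc_le (hV : IsBoundedPotential L V) {K N T : ℝ} (hK : 0 ≤ K)
    (hT : 1 ≤ T) (hN : 1 ≤ N) {M : ℕ} (hM : N ≤ M) {σ : Bool} (hσ : HasSide L σ) :
    ∫⁻ E in Ioc (-K) K,
        sideTail σ (greenVec (schrodinger L V hV) ((E : ℂ) + Complex.I / (T : ℂ))) (M + 1)
      ≤ ENNReal.ofReal (32 * T ^ 6 * sideIntegral V σ K N T) := by
  have hT0 : 0 < T := by linarith
  have hfin := finite_sideSet σ N
  have hne := nonempty_sideSet σ hN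
  have hcont := continuous_inv_maxTransferSq V hfin hne T
  have hpt : ∀ E : ℝ, sideTail σ (greenVec (schrodinger L V hV) ((E : ℂ) + Complex.I / (T : ℂ)))
      (M + 1) ≤ ENNReal.ofReal (32 * T ^ 6 *
        (maxTransferSq V (sideSet σ N) ((E : ℂ) + Complex.I / (T : ℂ)))⁻¹) := fun E => by
    obtain ⟨n, hn, hmax⟩ := exists_maxTransferSq_eq V hfin hne ((E : ℂ) + Complex.I / (T : ℂ))
    have hpos := maxTransferSq_pos V hfin hne ((E : ℂ) + Complex.I / (T : ℂ))
    obtain ⟨j, hj1, hj2, rfl⟩ := exists_of_mem_sideSet hn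
    rw [sideTail_eq]
    refine ENNReal.ofReal_le_ofReal ?_
    rw [← div_eq_mul_inv, le_div_iff₀ hpos, ← hmax]
    exact sideTail_mul_matNorm_le hT
      (greenVec_energy_spec (schrodinger_isSelfAdjoint L V hV) E hT0) (energy_im E T) hσ hj1
      (by exact_mod_cast hj2.trans hM)
  refine (lintegral_mono hpt).trans (le_of_eq ?_)
  rw [sideIntegral, ← intervalIntegral.integral_const_mul,
    intervalIntegral.integral_of_le (by linarith),
    ofReal_integral_eq_lintegral_ofReal]
  · exact ((hcont.const_mul (32 * T ^ 6)).intervalIntegrable (-K) K).1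
  · refine Eventually.of_forall fun E => ?_
    have hpos := maxTransferSq_pos V hfin hne ((E : ℂ) + Complex.I / (T : ℂ))
    positivity

/-- The outside probability, bounded by the energy integrals of the transfer matrices and an
exponentially small contribution of the energies outside `[-K, K]`. -/
theorem outsideProb_le (hV : IsBoundedPotential L V) {K : ℝ} (hK : 1 ≤ K)
    (hspec : spectrum ℂ (schrodinger L V hV) ⊆ (fun x : ℝ => (x : ℂ)) '' Icc (-K + 1) (K - 1))
    {N N' T B : ℝ} (hT : 1 ≤ T) (hN : 1 ≤ N) {M k : ℕ} (hM : N ≤ M) (hMN : (M : ℝ) ≤ N')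
    (hk : 2 * k ≤ M) (hB : ∀ σ, HasSide L σ → sideIntegral V σ K N T ≤ B) :
    outsideProb (schrodinger L V hV) N' T
      ≤ ENNReal.ofReal (2 * (32 * T ^ 6 * B + (3 ^ k)⁻¹)) := by
  have hT0 : 0 < T := by linarith
  have hH := schrodinger_isSelfAdjoint L V hV
  set H := schrodinger L V hV with hHdef
  set U : ℝ → Ell2 L := fun E => greenVec H ((E : ℂ) + Complex.I / (T : ℂ)) with hU
  set κ : ℝ≥0∞ := ENNReal.ofReal (Real.pi * T)⁻¹ with hκ
  have hκ1 : κ ≤ 1 := by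
    rw [hκ, ENNReal.ofReal_le_one]
    refine inv_le_one_of_one_le₀ ?_
    nlinarith [Real.pi_gt_three]
  have htrue : HasSide L true := by
    intro n hn
    cases L <;> simp [Lattice.sites, hn]
  have hB0 : 0 ≤ B := by
    refine le_trans ?_ (hB true htrue)
    refine intervalIntegral.integral_nonneg (by linarith) fun E _ => ?_
    exact inv_nonneg.2 (maxTransferSq_pos V (finite_sideSet _ _) (nonempty_sideSet _ hN) _).le
  have hnorm : ‖H‖ ≤ K - 1 := norm_le_of_spectrum hH (by linarith) (by
    have : -K + 1 = -(K - 1) := by ring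
    rwa [this] at hspec)
  -- Outside `[-K, K]` the form bound holds with constant `1`, hence the decay rate `1 + 2 * 1 = 3`.
  have hfar : ∀ σ, ∀ E ∈ (Ioc (-K) K)ᶜ,
      sideTail σ (U E) (M + 1) ≤ ENNReal.ofReal (3 ^ k)⁻¹ * ENNReal.ofReal (‖U E‖ ^ 2) := by
    intro σ E hE
    have hE' : K ≤ |E| := by
      by_contra h
      rw [not_le, abs_lt] at h
      exact hE ⟨h.1, h.2.le⟩
    have hform : ∀ v : Ell2 L, 1 * ‖v‖ ^ 2
        ≤ ‖inner ℂ v (H v - ((E : ℂ) + Complex.I / (T : ℂ)) • v)‖ := fun v => by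
      refine le_trans ?_ (sub_norm_mul_norm_sq_le hnorm _ v)
      gcongr
      linarith [abs_le_norm_energy E T]
    have h1 := sideTail_decay (greenVec_energy_spec hH E hT0) zero_le_one hform σ k
    rw [← ENNReal.ofReal_mul (by positivity)]
    refine le_trans ?_ (h1.trans (le_of_eq ?_))
    · rw [sideTail_eq, sideTail_eq]
      exact ENNReal.ofReal_le_ofReal (tailSq_anti (summable_restr _ _) (by omega))
    · norm_num [hU]
  have hside : ∀ σ, κ * ∫⁻ E, sideTail σ (U E) (M + 1)
      ≤ ENNReal.ofReal (32 * T ^ 6 * B + (3 ^ k)⁻¹) := by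
    intro σ
    rw [← lintegral_add_compl _ (measurableSet_Ioc (a := -K) (b := K)), mul_add,
      ENNReal.ofReal_add (by positivity) (by positivity)]
    refine add_le_add ?_ ?_
    · refine (mul_le_of_le_one_left' hκ1).trans ?_
      by_cases hσ : HasSide L σ
      · refine (lintegral_sideTail_Icc_le hV (by linarith) hT hN hM hσ).trans ?_
        refine ENNReal.ofReal_le_ofReal ?_
        gcongr
        exact hB σ hσ
      · simp [sideTail_eq_zero hσ]
    · calc κ * ∫⁻ E in (Ioc (-K) K)ᶜ, sideTail σ (U E) (M + 1)
          ≤ κ * ∫⁻ E in (Ioc (-K) K)ᶜ, ENNReal.ofReal (3 ^ k)⁻¹ * ENNReal.ofReal (‖U E‖ ^ 2) := by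
            gcongr κ * ?_
            exact setLIntegral_mono' measurableSet_Ioc.compl (hfar σ)
        _ ≤ κ * ∫⁻ E, ENNReal.ofReal (3 ^ k)⁻¹ * ENNReal.ofReal (‖U E‖ ^ 2) := by
            gcongr κ * ?_
            exact setLIntegral_le_lintegral _ _
        _ = ENNReal.ofReal (3 ^ k)⁻¹ * (κ * ∫⁻ E, ENNReal.ofReal (‖U E‖ ^ 2)) := by
            rw [lintegral_const_mul' _ _ ENNReal.ofReal_ne_top]
            ring
        _ = _ := by rw [lintegral_norm_greenVec hH hT0, mul_one]
  calc outsideProb H N' T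
      = κ * ∫⁻ E, ∑' n : {n : L.sites // N' < |((n : ℤ) : ℝ)|}, ‖U E n‖ₑ ^ 2 :=
        outsideProb_eq hH N' hT0
    _ ≤ κ * ∫⁻ E, (sideTail true (U E) (M + 1) + sideTail false (U E) (M + 1)) := by
        gcongr with E
        exact tsum_outside_le (U E) hMN
    _ = κ * (∫⁻ E, sideTail true (U E) (M + 1)) + κ * ∫⁻ E, sideTail false (U E) (M + 1) := by
        rw [lintegral_add_left (measurable_sideTail_greenVec hH true _ hT0), mul_add]
    _ ≤ _ := by
        rw [two_mul, ENNReal.ofReal_add (by positivity) (by positivity)]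
        exact add_le_add (hside true) (hside false)

/-- At every energy the resolvent vector decays exponentially on the scale `T`. -/
theorem avgProb_le (hV : IsBoundedPotential L V) {T : ℝ} (hT : 1 ≤ T) (n : L.sites) {k : ℕ}
    (hk : ((2 * k : ℕ) : ℝ) < |((n : ℤ) : ℝ)|) :
    ENNReal.ofReal (avgProb (schrodinger L V hV) n T)
      ≤ ENNReal.ofReal (2 * ((1 + 2 * (1 / T)) ^ k)⁻¹) := by
  have hT0 : 0 < T := by linarith
  have hH := schrodinger_isSelfAdjoint L V hV
  rw [ofReal_avgProb hH n hT0]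
  have hpt : ∀ E : ℝ, ‖greenVec (schrodinger L V hV) ((E : ℂ) + Complex.I / (T : ℂ)) n‖ₑ ^ 2
      ≤ ENNReal.ofReal (2 * ((1 + 2 * (1 / T)) ^ k)⁻¹) * ENNReal.ofReal
        (‖greenVec (schrodinger L V hV) ((E : ℂ) + Complex.I / (T : ℂ))‖ ^ 2) := fun E => by
    have hform : ∀ v : Ell2 L, 1 / T * ‖v‖ ^ 2 ≤ ‖inner ℂ v (schrodinger L V hV v
        - ((E : ℂ) + Complex.I / (T : ℂ)) • v)‖ := fun v => by
      rw [← energy_im E T]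
      exact im_mul_norm_sq_le hH _ v
    have hd := fun σ => sideTail_decay (greenVec_energy_spec hH E hT0)
      (by positivity : 0 ≤ 1 / T) hform σ k
    have h1 := tsum_outside_le (greenVec (schrodinger L V hV) ((E : ℂ) + Complex.I / (T : ℂ)))
      (le_refl ((2 * k : ℕ) : ℝ))
    refine le_trans (ENNReal.le_tsum (f := fun n : {n : L.sites // ((2 * k : ℕ) : ℝ)
      < |((n : ℤ) : ℝ)|} => ‖greenVec (schrodinger L V hV)
        ((E : ℂ) + Complex.I / (T : ℂ)) n‖ₑ ^ 2) ⟨n, hk⟩) ?_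
    refine h1.trans ((add_le_add (hd true) (hd false)).trans (le_of_eq ?_))
    rw [← ENNReal.ofReal_add (by positivity) (by positivity), ← ENNReal.ofReal_mul (by positivity)]
    congr 1
    ring
  refine (mul_le_mul_right (lintegral_mono hpt) _).trans (le_of_eq ?_)
  rw [lintegral_const_mul' _ _ ENNReal.ofReal_ne_top, mul_left_comm,
    lintegral_norm_greenVec hH hT0, mul_one]

end

section

/-! ### Decay of the outside probabilities -/

variable {L : Lattice} {V : ℤ → ℝ}

/-- Beyond `T ^ γ` with `γ > α` the outside probability decays faster than any power of `T`. -/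
theorem eventually_outsideProb_le (hV : IsBoundedPotential L V) {K : ℝ} (hK : 1 ≤ K)
    (hspec : spectrum ℂ (schrodinger L V hV) ⊆ (fun x : ℝ => (x : ℂ)) '' Icc (-K + 1) (K - 1))
    {C α : ℝ} (hC : 0 < C) (hα : 0 < α)
    (hside : ∀ σ, HasSide L σ → ∀ m : ℕ, 1 ≤ m →
      (fun T : ℝ => sideIntegral V σ K (C * T ^ α) T) =O[atTop] fun T : ℝ => T ^ (-(m : ℝ)))
    {γ : ℝ} (hγ : α < γ) (m : ℕ) :
    ∀ᶠ T : ℝ in atTop, outsideProb (schrodinger L V hV) (T ^ γ - 2) T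
      ≤ ENNReal.ofReal (T ^ (-(m : ℝ))) := by
  have hint : ∀ σ, ∀ᶠ T : ℝ in atTop, HasSide L σ →
      sideIntegral V σ K (C * T ^ α) T ≤ T ^ (-((m : ℝ) + 7)) := fun σ => by
    by_cases hσ : HasSide L σ
    · obtain ⟨c, hc⟩ := (hside σ hσ (m + 8) (by omega)).bound
      filter_upwards [hc, eventually_ge_atTop c, eventually_gt_atTop 0] with T h1 h2 h3 _
      refine (le_abs_self _).trans (h1.trans ?_)
      rw [Real.norm_of_nonneg (Real.rpow_nonneg h3.le _)]
      calc c * T ^ (-((m + 8 : ℕ) : ℝ)) ≤ T * T ^ (-((m + 8 : ℕ) : ℝ)) := by gcongr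
        _ = T ^ (-((m : ℝ) + 7)) := by
          rw [← Real.rpow_one_add' h3.le (by push_cast; linarith [m.cast_nonneg (α := ℝ)])]
          congr 1
          push_cast
          ring
    · exact Eventually.of_forall fun T h => absurd h hσ
  have hpow : Tendsto (fun T : ℝ => C * T ^ α) atTop atTop :=
    (tendsto_rpow_atTop hα).const_mul_atTop hC
  have hexp : ∀ᶠ T : ℝ in atTop, T ^ ((m : ℝ) + 1) * Real.exp (-(C / 2) * T ^ α) ≤
      Real.exp (-1) := by
    have h := (tendsto_rpow_mul_exp_neg_mul_atTop_nhds_zero (((m : ℝ) + 1) / α) (C / 2)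
      (by positivity)).comp (tendsto_rpow_atTop hα)
    filter_upwards [h.eventually_le_const (Real.exp_pos (-1)), eventually_gt_atTop 0] with T h1 h2
    have h3 : (T ^ α) ^ (((m : ℝ) + 1) / α) = T ^ ((m : ℝ) + 1) := by
      rw [← Real.rpow_mul h2.le]
      congr 1
      field_simp
    simpa [Function.comp, h3] using h1
  have hgap : ∀ᶠ T : ℝ in atTop, C * T ^ α + 1 ≤ T ^ γ - 2 := by
    have h1 := (tendsto_rpow_atTop (sub_pos.2 hγ)).eventually_ge_atTop (C + 3)
    filter_upwards [h1, eventually_ge_atTop 1] with T h2 h3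
    have h4 : T ^ γ = T ^ α * T ^ (γ - α) := by
      rw [← Real.rpow_add (by linarith)]
      congr 1
      ring
    have h5 : 1 ≤ T ^ α := Real.one_le_rpow h3 hα.le
    rw [h4]
    nlinarith
  filter_upwards [hint true, hint false, hpow.eventually_ge_atTop 1, hexp, hgap,
    eventually_ge_atTop 66] with T h1 h2 h3 h4 h5 h6
  have hT0 : 0 < T := by linarith
  have hceil := Nat.le_ceil (C * T ^ α)
  have hceil2 := Nat.ceil_lt_add_one (show 0 ≤ C * T ^ α by linarith)
  set M := ⌈C * T ^ α⌉₊ with hM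
  have hP := outsideProb_le hV hK hspec (T := T) (B := T ^ (-((m : ℝ) + 7))) (by linarith) h3 hceil
    (hceil2.le.trans h5) (k := M / 2) (by omega) (by
      intro σ hσ
      cases σ
      · exact h2 hσ
      · exact h1 hσ)
  refine hP.trans (ENNReal.ofReal_le_ofReal ?_)
  -- Halving `M` rounds down, which costs the `1`.
  have hk : C / 2 * T ^ α - 1 ≤ ((M / 2 : ℕ) : ℝ) := by
    have : M ≤ 2 * (M / 2) + 1 := by omega
    have : (M : ℝ) ≤ 2 * ((M / 2 : ℕ) : ℝ) + 1 := by exact_mod_cast this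
    linarith
  have h7 : ((3 : ℝ) ^ (M / 2))⁻¹ ≤ T ^ (-((m : ℝ) + 1)) := by
    rw [Real.rpow_neg hT0.le]
    refine inv_anti₀ (by positivity) ?_
    calc T ^ ((m : ℝ) + 1)
        = T ^ ((m : ℝ) + 1) * Real.exp (-(C / 2) * T ^ α) * Real.exp (C / 2 * T ^ α) := by
          rw [mul_assoc, ← Real.exp_add]
          simp
      _ ≤ Real.exp (-1) * Real.exp (C / 2 * T ^ α) := by gcongr
      _ = Real.exp (C / 2 * T ^ α - 1) := by rw [← Real.exp_add]; congr 1; ring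
      _ ≤ Real.exp ((M / 2 : ℕ) : ℝ) := Real.exp_le_exp.2 hk
      _ = Real.exp 1 ^ (M / 2) := by rw [← Real.exp_nat_mul, mul_one]
      _ ≤ 3 ^ (M / 2) := by
          gcongr
          linarith [Real.exp_one_lt_d9]
  have h8 : T ^ 6 * T ^ (-((m : ℝ) + 7)) = T ^ (-((m : ℝ) + 1)) := by
    rw [← Real.rpow_natCast, ← Real.rpow_add hT0]
    congr 1
    push_cast
    ring
  have h9 : T ^ (-(m : ℝ)) = T * T ^ (-((m : ℝ) + 1)) := by
    have := Real.rpow_add hT0 1 (-((m : ℝ) + 1))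
    rw [Real.rpow_one] at this
    rw [← this]
    congr 1
    ring
  -- The bound is `2 * (32 + 1) = 66` times `T ^ (-(m + 1))`, and `66 ≤ T`.
  rw [h9, mul_assoc, h8]
  have h10 : 0 ≤ T ^ (-((m : ℝ) + 1)) := by positivity
  nlinarith

/-- Far outside the ballistic region the averaged probabilities decay faster than any power of the
distance, uniformly in `T`. -/
theorem exists_avgProb_far_le (hV : IsBoundedPotential L V) (i : ℕ) :
    ∃ A : ℝ, 0 ≤ A ∧ ∀ T : ℝ, 2 ≤ T → ∀ n : L.sites, T ^ 2 < |((n : ℤ) : ℝ)| →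
      ENNReal.ofReal (avgProb (schrodinger L V hV) n T)
        ≤ ENNReal.ofReal (A * (|((n : ℤ) : ℝ)| ^ i)⁻¹) := by
  refine ⟨2 * ((2 * i).factorial * 36 ^ i), by positivity, fun T hT n hn => ?_⟩
  have hT0 : 0 < T := by linarith
  set x : ℝ := |((n : ℤ) : ℝ)| with hx
  have hx4 : 4 < x := by nlinarith
  set q : ℕ := ((n : ℤ).natAbs - 1) / 2 with hq
  have hxn : x = ((n : ℤ).natAbs : ℝ) := by rw [hx, Nat.cast_natAbs]; simp
  have hq1 : 2 * q < (n : ℤ).natAbs := by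
    have : (4 : ℝ) < ((n : ℤ).natAbs : ℝ) := hxn ▸ hx4
    have : 4 < (n : ℤ).natAbs := by exact_mod_cast this
    omega
  have hq2 : (n : ℤ).natAbs ≤ 2 * q + 2 := by omega
  have hq2' : x ≤ 2 * (q : ℝ) + 2 := by rw [hxn]; exact_mod_cast hq2
  have h1 := avgProb_le hV (by linarith : 1 ≤ T) n (k := q) (by
    rw [← hx, hxn]; exact_mod_cast hq1)
  refine h1.trans (ENNReal.ofReal_le_ofReal ?_)
  rw [mul_assoc]
  refine mul_le_mul_of_nonneg_left ?_ zero_le_two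
  rw [← inv_inv (((2 * i).factorial : ℝ) * 36 ^ i), ← mul_inv]
  refine inv_anti₀ (by positivity) ?_
  -- The decay `(1 + 2/T) ^ (-q)` with `q ≈ x/2` is at least as fast as `exp (-x/(6T))`, and
  -- `(x/T)² ≥ x` outside the radius `T²`, so a power `2 * i` of the exponent gives `x ^ i`.
  have hlog : 2 / (3 * T) ≤ Real.log (1 + 2 * (1 / T)) := by
    refine le_trans ?_ (Real.one_sub_inv_le_log_of_pos (by positivity))
    have : 1 - (1 + 2 * (1 / T))⁻¹ = 2 / (T + 2) := by field_simp; ring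
    rw [this]
    gcongr
    linarith
  have hy : x / (6 * T) ≤ q * Real.log (1 + 2 * (1 / T)) := by
    refine le_trans ?_ (mul_le_mul_of_nonneg_left hlog (by positivity))
    rw [mul_div_assoc', div_le_div_iff₀ (by positivity) (by positivity)]
    nlinarith
  calc (((2 * i).factorial : ℝ) * 36 ^ i)⁻¹ * x ^ i
      = (x / 36) ^ i / (2 * i).factorial := by
        rw [div_pow]
        field_simp
    _ ≤ (x / (6 * T)) ^ (2 * i) / (2 * i).factorial := by
        rw [pow_mul]
        gcongr
        rw [div_pow, div_le_div_iff₀ (by norm_num) (by positivity)]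
        nlinarith
    _ ≤ Real.exp (x / (6 * T)) := Real.pow_div_factorial_le_exp _ (by positivity) _
    _ ≤ Real.exp (q * Real.log (1 + 2 * (1 / T))) := Real.exp_le_exp.2 hy
    _ = (1 + 2 * (1 / T)) ^ q := by
        rw [Real.exp_nat_mul, Real.exp_log (by positivity)]

/-! ### Moments -/

/-- Splitting of a moment at two radii: the mass within `R₁`, the outside probability up to `R₂`,
and the remote part, dominated by `g`. -/
theorem moment_le {H : Ell2 L →L[ℂ] Ell2 L} (hH : IsSelfAdjoint H) {p T R₁ R₂ : ℝ} (hp : 0 ≤ p)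
    (hT : 0 < T) {g : L.sites → ℝ≥0∞}
    (hg : ∀ n : L.sites, R₂ < |((n : ℤ) : ℝ)| →
      ENNReal.ofReal (|((n : ℤ) : ℝ)| ^ p * avgProb H n T) ≤ g n) :
    moment H p T ≤ ENNReal.ofReal (R₁ ^ p) + ENNReal.ofReal (R₂ ^ p) * outsideProb H R₁ T
      + ∑' n, g n := by
  classical
  have hout : outsideProb H R₁ T = ∑' n : L.sites,
      {n : L.sites | R₁ < |((n : ℤ) : ℝ)|}.indicator
        (fun n => ENNReal.ofReal (avgProb H n T)) n :=
    tsum_subtype {n : L.sites | R₁ < |((n : ℤ) : ℝ)|} fun n => ENNReal.ofReal (avgProb H n T)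
  have h1 : ENNReal.ofReal (R₁ ^ p)
      = ∑' n : L.sites, ENNReal.ofReal (R₁ ^ p) * ENNReal.ofReal (avgProb H n T) := by
    rw [ENNReal.tsum_mul_left, tsum_ofReal_avgProb hH hT, mul_one]
  rw [hout, ← ENNReal.tsum_mul_left, h1, ← ENNReal.tsum_add, ← ENNReal.tsum_add]
  refine ENNReal.tsum_le_tsum fun n => ?_
  have hpos : ∀ R, |((n : ℤ) : ℝ)| ≤ R → ENNReal.ofReal (|((n : ℤ) : ℝ)| ^ p * avgProb H n T)
      ≤ ENNReal.ofReal (R ^ p) * ENNReal.ofReal (avgProb H n T) := fun R hR => by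
    rw [ENNReal.ofReal_mul (by positivity)]
    gcongr
  rcases le_or_gt |((n : ℤ) : ℝ)| R₁ with h | h
  · exact (hpos R₁ h).trans ((le_add_right le_rfl).trans (le_add_right le_rfl))
  · rcases le_or_gt |((n : ℤ) : ℝ)| R₂ with h' | h'
    · rw [indicator_of_mem (show n ∈ {n : L.sites | R₁ < |((n : ℤ) : ℝ)|} from h)]
      exact (hpos R₂ h').trans ((le_add_left le_rfl).trans (le_add_right le_rfl))
    · exact (hg n h').trans (le_add_left le_rfl)

theorem eventually_moment_le (hV : IsBoundedPotential L V) {α : ℝ} (hα : 0 < α)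
    (hout : ∀ γ, α < γ → ∀ m : ℕ, ∀ᶠ T : ℝ in atTop,
      outsideProb (schrodinger L V hV) (T ^ γ - 2) T ≤ ENNReal.ofReal (T ^ (-(m : ℝ))))
    {p : ℝ} (hp : 0 < p) {γ : ℝ} (hγ : α < γ) :
    ∀ᶠ T : ℝ in atTop, moment (schrodinger L V hV) p T ≤ ENNReal.ofReal (T ^ (p * γ)) := by
  obtain ⟨γ', hγ1, hγ2⟩ := exists_between hγ
  obtain ⟨i, hi⟩ := exists_nat_ge (p + 2)
  -- The weight `(T²) ^ p` of the intermediate sites is absorbed by `T ^ (-m)`.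
  obtain ⟨m, hm⟩ := exists_nat_ge (2 * p)
  obtain ⟨A, hA, hfar⟩ := exists_avgProb_far_le hV i
  set g : L.sites → ℝ := fun n => A * (|((n : ℤ) : ℝ)| ^ 2)⁻¹ with hg
  have hg0 : ∀ n, 0 ≤ g n := fun n => by positivity
  have hgs : Summable g := by
    have h := (Real.summable_one_div_int_pow (p := 2)).2 (by norm_num)
    refine ((h.comp_injective Subtype.val_injective).mul_left A).congr fun n => ?_
    simp [hg]
  have hR : ∀ᶠ T : ℝ in atTop, 2 + ∑' n, g n ≤ T ^ (p * (γ - γ')) :=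
    (tendsto_rpow_atTop (mul_pos hp (sub_pos.2 hγ2))).eventually_ge_atTop _
  have hRpos : ∀ᶠ T : ℝ in atTop, 2 ≤ T ^ γ' :=
    (tendsto_rpow_atTop (hα.trans hγ1)).eventually_ge_atTop _
  filter_upwards [hout γ' hγ1 m, hR, hRpos, eventually_ge_atTop 2] with T h1 h2 h3 hT
  have hT0 : 0 < T := by linarith
  have h4 := moment_le (schrodinger_isSelfAdjoint L V hV) hp.le hT0 (R₁ := T ^ γ' - 2)
    (R₂ := T ^ 2) (g := fun n => ENNReal.ofReal (g n)) (fun n hn => by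
      have hx : 1 ≤ |((n : ℤ) : ℝ)| := by nlinarith
      rw [ENNReal.ofReal_mul (by positivity)]
      refine (mul_le_mul_right (hfar T hT n hn) _).trans ?_
      rw [← ENNReal.ofReal_mul (by positivity)]
      refine ENNReal.ofReal_le_ofReal ?_
      simp only [hg]
      rw [mul_left_comm]
      refine mul_le_mul_of_nonneg_left ?_ hA
      rw [← div_eq_mul_inv, div_le_iff₀ (by positivity), inv_mul_eq_div,
        le_div_iff₀ (by positivity), ← Real.rpow_natCast, ← Real.rpow_natCast,
        ← Real.rpow_add (by positivity)]
      exact Real.rpow_le_rpow_of_exponent_le hx (by exact_mod_cast hi))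
  refine h4.trans ?_
  have h5 : ENNReal.ofReal ((T ^ 2) ^ p) * outsideProb (schrodinger L V hV) (T ^ γ' - 2) T
      ≤ ENNReal.ofReal 1 := by
    refine (mul_le_mul_right h1 _).trans ?_
    rw [← ENNReal.ofReal_mul (by positivity)]
    refine ENNReal.ofReal_le_ofReal ?_
    rw [← Real.rpow_natCast, ← Real.rpow_mul hT0.le, ← Real.rpow_add hT0]
    exact Real.rpow_le_one_of_one_le_of_nonpos (by linarith) (by push_cast; linarith)
  rw [← ENNReal.ofReal_tsum_of_nonneg hg0 hgs]
  have hG : 0 ≤ ∑' n, g n := tsum_nonneg hg0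
  refine (add_le_add (add_le_add le_rfl h5) le_rfl).trans ?_
  have hb : 0 ≤ T ^ γ' - 2 := by linarith
  rw [← ENNReal.ofReal_add (by positivity) zero_le_one,
    ← ENNReal.ofReal_add (by positivity) hG]
  refine ENNReal.ofReal_le_ofReal ?_
  have h6 : (T ^ γ' - 2) ^ p ≤ T ^ (p * γ') := by
    rw [mul_comm p, Real.rpow_mul hT0.le]
    exact Real.rpow_le_rpow hb (by linarith) hp.le
  have h7 : T ^ (p * γ) = T ^ (p * γ') * T ^ (p * (γ - γ')) := by
    rw [← Real.rpow_add hT0]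
    congr 1
    ring
  have h8 : 1 ≤ T ^ (p * γ') := Real.one_le_rpow (by linarith) (by nlinarith)
  rw [h7]
  nlinarith

/-! ### Exponents -/

/-- A power bound `f(T) ≤ T ^ s` controls the exponent `limsup log f(T) / (p log T)`. -/
theorem limsup_log_div_le {f : ℝ → ℝ≥0∞} {p s : ℝ} (hp : 0 < p)
    (h : ∀ᶠ T : ℝ in atTop, f T ≤ ENNReal.ofReal (T ^ (p * s))) :
    limsup (fun T : ℝ => ENNReal.log (f T) / ((p * Real.log T : ℝ) : EReal)) atTop
      ≤ (s : EReal) := by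
  refine limsup_le_of_le (by isBoundedDefault) ?_
  filter_upwards [h, eventually_gt_atTop 1] with T h1 h2
  have hlog := Real.log_pos h2
  have hT0 : 0 < T := by linarith
  have h3 : ENNReal.log (f T) ≤ ((p * s * Real.log T : ℝ) : EReal) := by
    refine (ENNReal.log_monotone h1).trans (le_of_eq ?_)
    rw [ENNReal.log_ofReal_of_pos (by positivity), Real.log_rpow hT0]
  refine (EReal.div_le_div_right_of_nonneg (by exact_mod_cast (by positivity)) h3).trans
    (le_of_eq ?_)
  rw [← EReal.coe_div]
  congr 1
  field_simp

end

end SchrodingerTransport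

open SchrodingerTransport in
theorem theorem2p1 (L : Lattice) (V : ℤ → ℝ) (hV : IsBoundedPotential L V)
    (K : ℝ) (hK : 4 ≤ K)
    (hspec : spectrum ℂ (schrodinger L V hV) ⊆ (fun x : ℝ => (x : ℂ)) '' Icc (-K + 1) (K - 1))
    (C α : ℝ) (hC : 0 < C) (hα : α ∈ Ioo (0 : ℝ) 1)
    (hright : ∀ m : ℕ, 1 ≤ m →
      (fun T : ℝ => rightIntegral V K (C * T ^ α) T) =O[atTop] fun T : ℝ => T ^ (-(m : ℝ)))
    (hleft : L = Lattice.line → ∀ m : ℕ, 1 ≤ m →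
      (fun T : ℝ => leftIntegral V K (C * T ^ α) T) =O[atTop] fun T : ℝ => T ^ (-(m : ℝ))) :
    alphaUPlus (schrodinger L V hV) ≤ (α : EReal) ∧
      ∀ p : ℝ, 0 < p → betaPlus (schrodinger L V hV) p ≤ (α : EReal) := by
  have hout : ∀ γ, α < γ → ∀ m : ℕ, ∀ᶠ T : ℝ in atTop,
      outsideProb (schrodinger L V hV) (T ^ γ - 2) T ≤ ENNReal.ofReal (T ^ (-(m : ℝ))) :=
    fun γ hγ m => eventually_outsideProb_le hV (by linarith) hspec hC hα.1 (fun σ hσ => by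
      cases σ with
      | true => exact hright
      | false =>
        refine hleft ?_
        cases L with
        | line => rfl
        | halfLine =>
          have h : (1 : ℤ) ≤ 1 - 1 := hσ 1 le_rfl
          omega) hγ m
  refine ⟨sSup_le ?_, fun p hp => ?_⟩
  · rintro _ ⟨γ, ⟨-, hγ⟩, rfl⟩
    by_contra hcon
    have hγα : α < γ := by simpa using hcon
    refine hγ.ne ?_
    unfold sPlus
    rw [EReal.neg_eq_top_iff, EReal.eq_bot_iff_forall_lt]
    intro y
    obtain ⟨m, hm⟩ := exists_nat_gt (-y)
    have h := limsup_log_div_le (f := fun T => outsideProb (schrodinger L V hV) (T ^ γ - 2) T)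
      (p := 1) (s := -(m : ℝ)) one_pos (by simpa using hout γ hγα m)
    simp only [one_mul] at h
    refine h.trans_lt ?_
    exact_mod_cast (by linarith : -(m : ℝ) < y)
  · refine EReal.le_of_forall_lt_iff_le.1 fun γ hγ => ?_
    exact limsup_log_div_le hp (eventually_moment_le hV hα.1 hout hp (by exact_mod_cast hγ))
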